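/- All spaces are simply connected (in particular non-empty and path connected) and of finite type over $\mathbb Q$, i.e. $\dim H_i(\,\cdot\,;\mathbb Q)<\infty$ for every $i$. For a continuous map $f:X\to Y$ of such spaces and $t\ge 0$ put $$P_f(t)=1+\sum_{i\ge 2}\dim\operatorname{Ker}\bigl(H_i(f;\mathbb Q):H_i(X;\mathbb Q)\to H_i(Y;\mathbb Q)\bigr)\,t^i,$$ $$HP^{\pi}_f(t)=\sum_{i\ge 2}\dim\operatorname{Ker}\bigl(\pi_i(f)\otimes\mathbb Q:\pi_i(X)\otimes\mathbb Q\to\pi_i(Y)\otimes\mathbb Q\bigr)\,t^i,\qquad HP^{\pi}_X(t)=\sum_{i\ge 2}\dim\bigl(\pi_i(X)\otimes\mathbb Q\bigr)\,t^i,$$ where these series with non-negative terms are evaluated in $[0,\infty]$ (so $P_f$ is a polynomial whenever $\dim\operatorname{Ker} H_*(f;\mathbb Q)<\infty$). Let $r_X$ be the radius of convergence of $HP^{\pi}_X$. The map $f$ is called rationally hyperbolic with respect to kernel if $\sum_i\dim\operatorname{Ker}H_i(f;\mathbb Q)<\infty$ and $\sum_i\dim\operatorname{Ker}(\pi_i(f)\otimes\mathbb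 Q)=\infty$. Let $f^n:X^n\to Y^n$ be the map $(x_1,\dots,x_n)\mapsto(f(x_1),\dots,f(x_n))$. **Corollary.** Let $f:X\to Y$ be a continuous map of simply connected spaces of finite type over $\mathbb Q$ that is rationally hyperbolic with respect to kernel, and suppose $P_f(1)>1$. Then for every real $r$ with $0<r<r_X$ there is a positive integer $n(r)$ such that for all $n\ge n(r)$ $$HP^{\pi}_{f^n}(r)<P_{f^n}(r).$$ (In particular $HP^{\pi}_{f^n}(r)$ is finite.) -/

import Mathlib

open scoped ENNReal NNReal TensorProduct

universe u

noncomputable section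

namespace RelHilali

/-! ### Dimensions -/

/-- The dimension of a rational vector space as an element of `[0, ∞]`
(it is `∞` exactly when the space is infinite dimensional). -/
def qdim (V : Type*) [AddCommGroup V] [Module ℚ V] : ℝ≥0∞ :=
  ((Module.rank ℚ V).toENat : ℝ≥0∞)

/-! ### Rational singular homology -/

/-- `H_i(X; ℚ)`: singular homology with rational coefficients. The coefficient module `ℚ` is
lifted to the universe of `X`. -/
abbrev rationalHomology (i : ℕ) (X : Type u) [TopologicalSpace X] : ModuleCat.{u} ℚ :=
  ((AlgebraicTopology.singularHomologyFunctor (ModuleCat.{u} ℚ) i).obj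
    (ModuleCat.of ℚ (ULift.{u} ℚ))).obj (TopCat.of X)

/-- `H_i(f; ℚ) : H_i(X; ℚ) → H_i(Y; ℚ)`. -/
def rationalHomologyMap (i : ℕ) {X Y : Type u} [TopologicalSpace X] [TopologicalSpace Y]
    (f : C(X, Y)) : rationalHomology i X →ₗ[ℚ] rationalHomology i Y :=
  (((AlgebraicTopology.singularHomologyFunctor (ModuleCat.{u} ℚ) i).obj
    (ModuleCat.of ℚ (ULift.{u} ℚ))).map (TopCat.ofHom f)).hom

/-- `X` is of finite type over `ℚ`: every `H_i(X; ℚ)` is finite dimensional. -/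
def FiniteTypeQ (X : Type u) [TopologicalSpace X] : Prop :=
  ∀ i : ℕ, Module.Finite ℚ (rationalHomology i X)

/-! ### Rational homotopy groups -/

section Homotopy

variable {X Y : Type u} [TopologicalSpace X] [TopologicalSpace Y]

/-- Composition of a generalized loop with a continuous map. -/
def genLoopMap {N : Type} (f : C(X, Y)) (x : X) (p : GenLoop N X x) : GenLoop N Y (f x) :=
  ⟨f.comp p.1, fun y hy => congrArg f (p.2 y hy)⟩

/-- The map of sets `π_i(X, x) → π_i(Y, f x)` induced by `f`. -/
def homotopyGroupMapFun (i : ℕ) (f : C(X, Y)) (x : X) :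
    HomotopyGroup.Pi i X x → HomotopyGroup.Pi i Y (f x) :=
  Quotient.map (genLoopMap f x) (fun _ _ h => h.comp_continuousMap f)

/-- The group homomorphism `π_i(f) : π_i(X, x) → π_i(Y, f x)`, in degree `i = k + 2`. -/
def homotopyGroupMap (k : ℕ) (f : C(X, Y)) (x : X) :
    HomotopyGroup.Pi (k + 2) X x →* HomotopyGroup.Pi (k + 2) Y (f x) :=
  MonoidHom.mk' (homotopyGroupMapFun (k + 2) f x) (by
    rintro ⟨p⟩ ⟨q⟩
    refine (congrArg (homotopyGroupMapFun (k + 2) f x)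
      (HomotopyGroup.mul_spec (i := (0 : Fin (k + 2))) (p := p) (q := q))).trans ?_
    refine Eq.trans ?_ (HomotopyGroup.mul_spec (i := (0 : Fin (k + 2)))
      (p := genLoopMap f x p) (q := genLoopMap f x q)).symm
    refine congrArg (Quotient.mk _) ?_
    ext t
    exact apply_ite f _ _ _)

/-- `π_i(X, x) ⊗ ℚ` in degree `i = k + 2`, a rational vector space. -/
abbrev rationalPi (k : ℕ) (X : Type u) [TopologicalSpace X] (x : X) : Type u :=
  ℚ ⊗[ℤ] Additive (HomotopyGroup.Pi (k + 2) X x)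

/-- `π_i(f) ⊗ ℚ : π_i(X, x) ⊗ ℚ → π_i(Y, f x) ⊗ ℚ` in degree `i = k + 2`. -/
def rationalPiMap (k : ℕ) (f : C(X, Y)) (x : X) :
    rationalPi k X x →ₗ[ℚ] rationalPi k Y (f x) :=
  LinearMap.baseChange ℚ (MonoidHom.toAdditive (homotopyGroupMap k f x)).toIntLinearMap

/-! ### Poincaré polynomials and Hilbert–Poincaré series

All coefficients are non-negative, so the series are evaluated at `t ≥ 0` in `[0, ∞]`;
divergence means the value `∞`. -/

/-- `P_f(t) = 1 + ∑_{i ≥ 2} dim Ker H_i(f; ℚ) t^i`. -/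
def homologicalPoincare (f : C(X, Y)) (t : ℝ≥0) : ℝ≥0∞ :=
  1 + ∑' k : ℕ, qdim (LinearMap.ker (rationalHomologyMap (k + 2) f)) * (t : ℝ≥0∞) ^ (k + 2)

/-- `HP^π_f(t) = ∑_{i ≥ 2} dim Ker (π_i(f) ⊗ ℚ) t^i`. -/
def homotopicalHilbertPoincare (f : C(X, Y)) (x : X) (t : ℝ≥0) : ℝ≥0∞ :=
  ∑' k : ℕ, qdim (LinearMap.ker (rationalPiMap k f x)) * (t : ℝ≥0∞) ^ (k + 2)

/-- `HP^π_X(t) = ∑_{i ≥ 2} dim (π_i(X) ⊗ ℚ) t^i`. -/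
def spaceHilbertPoincare (X : Type u) [TopologicalSpace X] (x : X) (t : ℝ≥0) : ℝ≥0∞ :=
  ∑' k : ℕ, qdim (rationalPi k X x) * (t : ℝ≥0∞) ^ (k + 2)

/-- `r_X`, the radius of convergence of `HP^π_X`: the supremum of all `t ≥ 0` at which the series
(with non-negative coefficients) converges. -/
def homotopyRadius (X : Type u) [TopologicalSpace X] (x : X) : ℝ≥0∞ :=
  ⨆ (t : ℝ≥0) (_ : spaceHilbertPoincare X x t < ∞), (t : ℝ≥0∞)

/-- `f` is rationally hyperbolic with respect to kernel: `∑_i dim Ker H_i(f; ℚ)` is finite and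
`∑_i dim Ker (π_i(f) ⊗ ℚ)` is infinite. The second sum runs over `i ≥ 2`, since `π_1` vanishes
for the simply connected spaces considered. -/
structure RationallyHyperbolicKer (f : C(X, Y)) (x : X) : Prop where
  homology_finite : ∑' i : ℕ, qdim (LinearMap.ker (rationalHomologyMap i f)) < ∞
  homotopy_infinite : ∑' k : ℕ, qdim (LinearMap.ker (rationalPiMap k f x)) = ∞

/-- The `n`-fold product `f^n : X^n → Y^n`, `(x_1, …, x_n) ↦ (f x_1, …, f x_n)`. -/
def powMap (f : C(X, Y)) (n : ℕ) : C(Fin n → X, Fin n → Y) :=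
  ⟨fun z j => f (z j), by fun_prop⟩

end Homotopy

end RelHilali

end

/-! The two sides grow at different rates in `n`. Rational homotopy turns a power into a direct sum,
so the kernel series of `f^n` at `r` is at most `n` times the series of `X`, which is finite since
`r < r_X` (`homotopicalHilbertPoincare_powMap_le`). Homology grows faster. Since `P_f(1) > 1`, some
nonzero class `h` of degree `d ≥ 2` is killed by `f`. For `i < j`, the cross product of `h` with
itself, placed in coordinates `i` and `j` of `X^n`, is killed by `f^n`, and these `n(n-1)/2` classes
are independent (`sum_range_le_qdim_ker`). Hence `P_{f^n}(r) ≥ 1 + n(n-1)/2 · r^(2d)`, which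
eventually exceeds any linear bound.

Only a fragment of the Künneth theorem is needed, and it is proved on chains. The class is
represented by a cycle all of whose faces vanish. Shuffle products of such cycles are cycles, and
are boundaries if one factor bounds (`δ_shuffle_of_ne_zero`, `δ_zero_shuffle`,
`exists_altFace_eq_shuffle`). Independence is tested with Alexander–Whitney products of a normalized
cocycle `φ` taking the value `1` on the cycle: they vanish on boundaries
(`alexanderWhitney_altFace`), are `±1` on the matching pair of coordinates
(`sum_front_back_shuffle`) and `0` on every other pair, because a constant simplex of positive
degree is degenerate. -/

open CategoryTheory Opposite Simplicial

namespace RelHilali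

/-! ### Collapse maps and shuffles -/

/-- The number of elements of `T` below `j`. -/
def countBelow (T : Finset ℕ) (j : ℕ) : ℕ := (T.filter (· < j)).card

lemma countBelow_mono (T : Finset ℕ) : Monotone (countBelow T) := fun _ _ h =>
  Finset.card_le_card (Finset.monotone_filter_right _ fun _ _ hx => lt_of_lt_of_le hx h)

@[simp] lemma countBelow_zero (T : Finset ℕ) : countBelow T 0 = 0 := by
  simp [countBelow]

lemma countBelow_le_card (T : Finset ℕ) (j : ℕ) : countBelow T j ≤ T.card :=
  Finset.card_filter_le _ _

lemma countBelow_succ (T : Finset ℕ) (j : ℕ) :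
    countBelow T (j + 1) = countBelow T j + if j ∈ T then 1 else 0 := by
  have h : T.filter (· < j + 1) = T.filter (· < j) ∪ T.filter (· = j) := by
    ext x; simp only [Finset.mem_filter, Finset.mem_union]; grind
  have hd : Disjoint (T.filter (· < j)) (T.filter (· = j)) := by
    rw [Finset.disjoint_filter]; grind
  rw [countBelow, h, Finset.card_union_of_disjoint hd, Finset.filter_eq']
  split_ifs <;> simp [countBelow]

/-- The monotone map `[n] → [p]` that goes up by one at the steps in `T`. -/
def collapse (T : Finset ℕ) (n p : ℕ) : ⦋n⦌ ⟶ ⦋p⦌ :=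
  SimplexCategory.mkHom ⟨fun j => ⟨min (countBelow T j) p, by omega⟩, fun _ _ h =>
    Fin.mk_le_mk.2 (min_le_min_right p (countBelow_mono T h))⟩

@[simp] lemma collapse_apply_val (T : Finset ℕ) (n p : ℕ) (j : Fin (n + 1)) :
    ((collapse T n p).toOrderHom j : ℕ) = min (countBelow T j) p := rfl

lemma hom_ext_val {n p : ℕ} {g h : ⦋n⦌ ⟶ ⦋p⦌}
    (H : ∀ j : Fin (n + 1), (g.toOrderHom j : ℕ) = h.toOrderHom j) : g = h := by
  ext j : 3
  exact Fin.ext (H j)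

lemma comp_apply_toOrderHom {n m p : ℕ} (g : ⦋n⦌ ⟶ ⦋m⦌) (h : ⦋m⦌ ⟶ ⦋p⦌) (j : Fin (n + 1)) :
    (g ≫ h).toOrderHom j = h.toOrderHom (g.toOrderHom j) := rfl

lemma δ_apply_val {n : ℕ} (i : Fin (n + 2)) (j : Fin (n + 1)) :
    ((SimplexCategory.δ i).toOrderHom j : ℕ) = if (j : ℕ) < i then (j : ℕ) else j + 1 := by
  change ((Fin.succAbove i j : Fin (n + 2)) : ℕ) = _
  simp only [Fin.succAbove, Fin.lt_def, Fin.val_castSucc]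
  split_ifs <;> simp

/-- The transposition of `i` and `i + 1`, applied to a set. -/
def swapStep (i : ℕ) (T : Finset ℕ) : Finset ℕ := T.map (Equiv.swap i (i + 1)).toEmbedding

lemma mem_swapStep {i x : ℕ} {T : Finset ℕ} :
    x ∈ swapStep i T ↔ Equiv.swap i (i + 1) x ∈ T := by
  rw [swapStep, Finset.mem_map_equiv, Equiv.symm_swap]

@[simp] lemma swapStep_swapStep (i : ℕ) (T : Finset ℕ) : swapStep i (swapStep i T) = T := by
  ext x; simp [mem_swapStep]

@[simp] lemma card_swapStep (i : ℕ) (T : Finset ℕ) : (swapStep i T).card = T.card :=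
  Finset.card_map _

lemma swap_step_apply (i x : ℕ) :
    Equiv.swap i (i + 1) x = if x = i then i + 1 else if x = i + 1 then i else x :=
  Equiv.swap_apply_def _ _ _

lemma swapStep_subset {i n : ℕ} (hi : i + 1 < n) {T : Finset ℕ} (hT : T ⊆ Finset.range n) :
    swapStep i T ⊆ Finset.range n := by
  intro x hx
  have := Finset.mem_range.1 (hT (mem_swapStep.1 hx))
  rw [swap_step_apply] at this
  rw [Finset.mem_range]
  split_ifs at this <;> omega

lemma range_sdiff_swapStep {i n : ℕ} (hi : i + 1 < n) (T : Finset ℕ) :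
    Finset.range n \ swapStep i T = swapStep i (Finset.range n \ T) := by
  ext x
  simp only [Finset.mem_sdiff, mem_swapStep, Finset.mem_range]
  refine and_congr_left fun _ => ?_
  rw [swap_step_apply]
  split_ifs <;> omega

/-- The initial segment below `i + 1` is the only one that separates `i` from `i + 1`. -/
lemma countBelow_swapStep {i j : ℕ} (h : j ≠ i + 1) (T : Finset ℕ) :
    countBelow (swapStep i T) j = countBelow T j := by
  have : (swapStep i T).filter (· < j) = swapStep i (T.filter (· < j)) := by
    ext x
    simp only [Finset.mem_filter, mem_swapStep]
    refine and_congr_right fun _ => ?_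
    rw [swap_step_apply]
    split_ifs <;> omega
  rw [countBelow, this, card_swapStep, countBelow]

/-- Moving one element by one step changes the sum by one. The parity of `∑ x ∈ T, x` gives the
usual shuffle sign up to a factor depending only on the size of `T`, and is easier to track. -/
lemma neg_one_pow_sum_swapStep {i : ℕ} {T : Finset ℕ} (h : i ∈ T ↔ i + 1 ∉ T) :
    (-1 : ℤ) ^ (∑ x ∈ swapStep i T, x) = -(-1) ^ (∑ x ∈ T, x) := by
  rw [swapStep, Finset.sum_map]
  simp only [Equiv.coe_toEmbedding]
  have aux : ∀ k ∈ T, (∀ x ∈ T.erase k, Equiv.swap i (i + 1) x = x) →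
      (-1 : ℤ) ^ (∑ x ∈ T, Equiv.swap i (i + 1) x)
        = (-1) ^ (Equiv.swap i (i + 1) k) * (-1) ^ (∑ x ∈ T.erase k, x) := by
    intro k hk hx
    rw [← Finset.add_sum_erase _ _ hk, pow_add, Finset.sum_congr rfl hx]
  by_cases hi : i ∈ T
  · rw [aux i hi, ← Finset.add_sum_erase _ _ hi, Equiv.swap_apply_left, pow_add, pow_succ]
    · ring
    · intro x hx
      rw [swap_step_apply]
      grind
  · have hi' : i + 1 ∈ T := by tauto
    rw [aux _ hi', ← Finset.add_sum_erase _ _ hi', Equiv.swap_apply_right, pow_add, pow_succ]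
    · ring
    · intro x hx
      rw [swap_step_apply]
      grind

/-! ### Simplicial modules -/

variable {A B C : SimplicialObject (ModuleCat.{u} ℚ)}

/-- All proper faces of `a`, except possibly the face opposite to `0`, vanish. -/
def HigherFacesZero {p : ℕ} (a : A _⦋p⦌) : Prop :=
  ∀ ⦃k : ℕ⦄ (g : ⦋k⦌ ⟶ ⦋p⦌) (v : Fin (p + 1)), v ≠ 0 → (∀ x, g.toOrderHom x ≠ v) →
    (A.map g.op).hom a = 0

/-- All proper faces of `a` vanish. -/
def FacesZero {p : ℕ} (a : A _⦋p⦌) : Prop :=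
  ∀ ⦃k : ℕ⦄ (g : ⦋k⦌ ⟶ ⦋p⦌) (v : Fin (p + 1)), (∀ x, g.toOrderHom x ≠ v) →
    (A.map g.op).hom a = 0

lemma FacesZero.higherFacesZero {p : ℕ} {a : A _⦋p⦌} (h : FacesZero a) : HigherFacesZero a :=
  fun _ g v _ hv => h g v hv

lemma map_map_apply {k m n : ℕ} (g : ⦋k⦌ ⟶ ⦋m⦌) (h : ⦋m⦌ ⟶ ⦋n⦌) (a : A _⦋n⦌) :
    (A.map g.op).hom ((A.map h.op).hom a) = (A.map (g ≫ h).op).hom a := by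
  rw [op_comp, A.map_comp, ModuleCat.hom_comp, LinearMap.comp_apply]

lemma map_eq_zero_of_δ {p k : ℕ} {a : A _⦋p + 1⦌} {v : Fin (p + 2)} (h : (A.δ v).hom a = 0)
    (g : ⦋k⦌ ⟶ ⦋p + 1⦌) (hv : ∀ x, g.toOrderHom x ≠ v) : (A.map g.op).hom a = 0 := by
  obtain ⟨g', rfl⟩ := SimplexCategory.eq_comp_δ_of_not_surjective' g v hv
  have h' : (A.map (SimplexCategory.δ v).op).hom a = 0 := h
  rw [← map_map_apply, h', map_zero]

lemma higherFacesZero_of_δ {p : ℕ} {a : A _⦋p + 1⦌}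
    (h : ∀ v : Fin (p + 2), v ≠ 0 → (A.δ v).hom a = 0) : HigherFacesZero a :=
  fun _ g v hv0 hv => map_eq_zero_of_δ (h v hv0) g hv

lemma facesZero_of_δ {p : ℕ} {a : A _⦋p + 1⦌}
    (h : ∀ v : Fin (p + 2), (A.δ v).hom a = 0) : FacesZero a :=
  fun _ g v hv => map_eq_zero_of_δ (h v) g hv

variable (A B C) in
/-- A degreewise bilinear map compatible with the simplicial structures. -/
structure SimplicialBilinear where
  /-- the bilinear map in each degree -/
  app (n : ℕ) : A _⦋n⦌ →ₗ[ℚ] B _⦋n⦌ →ₗ[ℚ] C _⦋n⦌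
  naturality {n m : ℕ} (g : ⦋n⦌ ⟶ ⦋m⦌) (a : A _⦋m⦌) (b : B _⦋m⦌) :
    (C.map g.op).hom (app m a b) = app n ((A.map g.op).hom a) ((B.map g.op).hom b)

/-- The shuffle product of `a` in degree `p` and `b` in degree `q`; here `n` is meant to be
`p + q`. -/
noncomputable def shuffle (μ : SimplicialBilinear A B C) {p q : ℕ} (n : ℕ)
    (a : A _⦋p⦌) (b : B _⦋q⦌) : C _⦋n⦌ :=
  ∑ T ∈ Finset.powersetCard p (Finset.range n), (-1 : ℤ) ^ (∑ x ∈ T, x) •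
    μ.app n ((A.map (collapse T n p).op).hom a)
      ((B.map (collapse (Finset.range n \ T) n q).op).hom b)

lemma map_shuffle (μ : SimplicialBilinear A B C) {p q n k : ℕ}
    (a : A _⦋p⦌) (b : B _⦋q⦌) (g : ⦋k⦌ ⟶ ⦋n⦌) :
    (C.map g.op).hom (shuffle μ n a b) =
      ∑ T ∈ Finset.powersetCard p (Finset.range n), (-1 : ℤ) ^ (∑ x ∈ T, x) •
        μ.app k ((A.map (g ≫ collapse T n p).op).hom a)
          ((B.map (g ≫ collapse (Finset.range n \ T) n q).op).hom b) := by
  rw [shuffle, map_sum]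
  refine Finset.sum_congr rfl fun T _ => ?_
  rw [map_zsmul, μ.naturality, map_map_apply, map_map_apply]

/-- If two consecutive steps (or the last one) lie in `T`, the face between them misses a
vertex. -/
lemma δ_collapse_misses {T : Finset ℕ} {n p : ℕ} (hp : T.card = p) {i : Fin (n + 2)} (hi : i ≠ 0)
    (h₁ : (i : ℕ) - 1 ∈ T) (h₂ : (i : ℕ) ≤ n → (i : ℕ) ∈ T) :
    ∃ v : Fin (p + 1), v ≠ 0 ∧
      ∀ x, (SimplexCategory.δ i ≫ collapse T (n + 1) p).toOrderHom x ≠ v := by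
  have hi0 : (i : ℕ) ≠ 0 := fun h => hi (Fin.ext h)
  obtain ⟨j, hj⟩ : ∃ j, (i : ℕ) = j + 1 := ⟨i - 1, by omega⟩
  have e₁ : countBelow T i = countBelow T j + 1 := by
    rw [hj, countBelow_succ, if_pos (by simpa [hj] using h₁)]
  have hle := countBelow_le_card T i
  -- The missed vertex is the value of the collapse at the skipped vertex `i`: earlier vertices have
  -- strictly smaller values, later ones strictly larger values.
  refine ⟨⟨countBelow T i, by omega⟩, ?_, fun x hx => ?_⟩
  · intro h
    have := congrArg Fin.val h
    simp at this
    omega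
  · have hx' := congrArg Fin.val hx
    rw [comp_apply_toOrderHom, collapse_apply_val, δ_apply_val] at hx'
    simp only at hx'
    have hb := countBelow_le_card T
    split_ifs at hx' with hlt
    · have := countBelow_mono T (show (x : ℕ) ≤ j by omega)
      omega
    · have hin : (i : ℕ) ≤ n := by omega
      have e₂ := countBelow_succ T i
      rw [if_pos (h₂ hin)] at e₂
      have := countBelow_mono T (show (i : ℕ) + 1 ≤ (x : ℕ) + 1 by omega)
      have := hb ((x : ℕ) + 1)
      omega

lemma δ_collapse_misses_zero {T : Finset ℕ} {n p : ℕ} (hp : 0 < p) (h : 0 ∈ T) :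
    ∀ x, (SimplexCategory.δ 0 ≫ collapse T (n + 1) p).toOrderHom x ≠ 0 := by
  intro x hx
  have hx' := congrArg Fin.val hx
  rw [comp_apply_toOrderHom, collapse_apply_val, δ_apply_val] at hx'
  have e := countBelow_succ T 0
  rw [if_pos h] at e
  have := countBelow_mono T (show 0 + 1 ≤ (x : ℕ) + 1 by omega)
  simp at hx'
  omega

/-- The two collapse maps can differ only at vertex `j + 1`, which is the one that `δ i` skips. -/
lemma δ_collapse_swapStep {T : Finset ℕ} {n p : ℕ} (i : Fin (n + 2)) {j : ℕ}
    (hj : (i : ℕ) = j + 1) :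
    SimplexCategory.δ i ≫ collapse (swapStep j T) (n + 1) p =
      SimplexCategory.δ i ≫ collapse T (n + 1) p := by
  refine hom_ext_val fun x => ?_
  rw [comp_apply_toOrderHom, comp_apply_toOrderHom, collapse_apply_val, collapse_apply_val,
    countBelow_swapStep]
  rw [δ_apply_val]
  split_ifs <;> omega

/-- Vertex `i = j + 1` lies between steps `j` and `j + 1`. If both belong to `T`, the term contains
a face of `a` that vanishes; if neither does, a face of `b`. The mixed terms cancel in pairs under
exchanging the two steps. -/
theorem δ_shuffle_of_ne_zero (μ : SimplicialBilinear A B C) {p q n : ℕ} (hn : n + 1 = p + q)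
    {a : A _⦋p⦌} {b : B _⦋q⦌} (ha : HigherFacesZero a) (hb : HigherFacesZero b)
    {i : Fin (n + 2)} (hi : i ≠ 0) : (C.δ i).hom (shuffle μ (n + 1) a b) = 0 := by
  have hi0 : (i : ℕ) ≠ 0 := fun h => hi (Fin.ext h)
  obtain ⟨j, hj⟩ : ∃ j, (i : ℕ) = j + 1 := ⟨i - 1, by omega⟩
  refine (map_shuffle μ a b (SimplexCategory.δ i)).trans ?_
  have zeroA : ∀ T ∈ Finset.powersetCard p (Finset.range (n + 1)), j ∈ T →
      ((i : ℕ) ≤ n → (i : ℕ) ∈ T) →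
      (A.map (SimplexCategory.δ i ≫ collapse T (n + 1) p).op).hom a = 0 := by
    intro T hT h₁ h₂
    rw [Finset.mem_powersetCard] at hT
    obtain ⟨v, hv, H⟩ := δ_collapse_misses hT.2 hi (by simpa [hj] using h₁) h₂
    exact ha _ v hv H
  have zeroB : ∀ T ∈ Finset.powersetCard p (Finset.range (n + 1)), j ∉ T →
      ((i : ℕ) ≤ n → (i : ℕ) ∉ T) →
      (B.map (SimplexCategory.δ i ≫ collapse (Finset.range (n + 1) \ T) (n + 1) q).op).hom b
        = 0 := by
    intro T hT h₁ h₂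
    rw [Finset.mem_powersetCard] at hT
    have hcard : (Finset.range (n + 1) \ T).card = q := by
      rw [Finset.card_sdiff_of_subset hT.1, Finset.card_range, hT.2]; omega
    obtain ⟨v, hv, H⟩ := δ_collapse_misses hcard hi
      (by simp only [hj, Finset.mem_sdiff, Finset.mem_range]
          exact ⟨by omega, by simpa using h₁⟩)
      (fun h => by simp only [Finset.mem_sdiff, Finset.mem_range]; exact ⟨by omega, h₂ h⟩)
    exact hb _ v hv H
  by_cases hin : (i : ℕ) ≤ n
  · refine Finset.sum_involution (fun T _ => swapStep j T) ?_ ?_ ?_ ?_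
    · intro T hT
      by_cases hmix : j ∈ T ↔ j + 1 ∉ T
      · rw [range_sdiff_swapStep (by omega), δ_collapse_swapStep i hj, δ_collapse_swapStep i hj,
          neg_one_pow_sum_swapStep hmix, neg_smul, add_neg_cancel]
      · by_cases hjT : j ∈ T
        · have h2 : (i : ℕ) ∈ T := by rw [hj]; tauto
          rw [range_sdiff_swapStep (by omega), δ_collapse_swapStep i hj,
            δ_collapse_swapStep i hj, zeroA T hT hjT fun _ => h2]
          simp
        · have h2 : (i : ℕ) ∉ T := by rw [hj]; tauto
          rw [range_sdiff_swapStep (by omega), δ_collapse_swapStep i hj,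
            δ_collapse_swapStep i hj, zeroB T hT hjT fun _ => h2]
          simp
    -- A set fixed by the exchange contains both steps or neither, so its term is already zero.
    · intro T hT hne heq
      apply hne
      have hiff : j ∈ T ↔ j + 1 ∈ T := by
        conv_lhs => rw [← heq, mem_swapStep, Equiv.swap_apply_left]
      by_cases hjT : j ∈ T
      · rw [zeroA T hT hjT fun _ => by rw [hj]; tauto]
        simp
      · rw [zeroB T hT hjT fun _ => by rw [hj]; tauto]
        simp
    · intro T hT
      rw [Finset.mem_powersetCard] at hT ⊢
      exact ⟨swapStep_subset (by omega) hT.1, by rw [card_swapStep, hT.2]⟩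
    · intro T _
      exact swapStep_swapStep j T
  -- Here `i = n + 1` is the last vertex, adjacent to the single step `j = n`, so every term
  -- vanishes on its own.
  · refine Finset.sum_eq_zero fun T hT => ?_
    by_cases hjT : j ∈ T
    · rw [zeroA T hT hjT fun h => absurd h hin]
      simp
    · rw [zeroB T hT hjT fun h => absurd h hin]
      simp

/-- If step `0` is not in `T`, a face of `b` appears and the term vanishes. The remaining `T` are
`{0}` together with a shifted `p`-subset of the `n` remaining steps; shifting adds `p` to the sum,
whence the sign. -/
theorem δ_zero_shuffle (μ : SimplicialBilinear A B C) {p q n : ℕ} (hn : n = p + q)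
    {a : A _⦋p + 1⦌} {b : B _⦋q⦌} (hb : FacesZero b) :
    (C.δ 0).hom (shuffle μ (n + 1) a b) = (-1 : ℤ) ^ p • shuffle μ n ((A.δ 0).hom a) b := by
  refine (map_shuffle μ a b (SimplexCategory.δ 0)).trans ?_
  have zeroB : ∀ T ∈ Finset.powersetCard (p + 1) (Finset.range (n + 1)), 0 ∉ T →
      (B.map (SimplexCategory.δ 0 ≫ collapse (Finset.range (n + 1) \ T) (n + 1) q).op).hom b
        = 0 := by
    intro T hT h
    rw [Finset.mem_powersetCard] at hT
    have h0 : 0 ∈ Finset.range (n + 1) \ T := by simp [h]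
    have hcard : (Finset.range (n + 1) \ T).card = q := by
      rw [Finset.card_sdiff_of_subset hT.1, Finset.card_range, hT.2]; omega
    have hq : 0 < q := by rw [← hcard]; exact Finset.card_pos.2 ⟨0, h0⟩
    exact hb _ 0 (δ_collapse_misses_zero hq h0)
  rw [← Finset.sum_filter_of_ne (p := fun T => 0 ∈ T)]
  swap
  · intro T hT hne
    by_contra h
    exact hne (by rw [zeroB T hT h]; simp)
  rw [shuffle, Finset.smul_sum]
  let s : ℕ ↪ ℕ := ⟨Nat.succ, Nat.succ_injective⟩
  symm
  refine Finset.sum_bij (fun T _ => insert 0 (T.map s)) ?_ ?_ ?_ ?_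
  · intro T hT
    rw [Finset.mem_powersetCard] at hT
    simp only [Finset.mem_filter, Finset.mem_powersetCard, Finset.mem_insert_self, and_true]
    refine ⟨?_, ?_⟩
    · intro x hx
      simp only [Finset.mem_insert, Finset.mem_map] at hx
      rcases hx with rfl | ⟨y, hy, rfl⟩
      · simp
      · have := Finset.mem_range.1 (hT.1 hy)
        simpa [s] using this
    · rw [Finset.card_insert_of_notMem (by simp [s]), Finset.card_map, hT.2]
  · intro T hT T' hT' h
    ext x
    have := congrArg (fun U : Finset ℕ => x + 1 ∈ U) h
    simpa [s] using this
  · intro T hT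
    simp only [Finset.mem_filter, Finset.mem_powersetCard] at hT
    obtain ⟨⟨hsub, hcard⟩, h0⟩ := hT
    have hins : insert 0 (((Finset.range n).filter (· + 1 ∈ T)).map s) = T := by
      ext x
      rcases x with _ | x
      · simp [h0]
      · simp only [Finset.mem_insert, Finset.mem_map, Finset.mem_filter, Finset.mem_range, s]
        constructor
        · rintro (h | ⟨y, ⟨_, hy⟩, h⟩)
          · simp at h
          · simp at h; rwa [← h]
        · intro hx
          have := Finset.mem_range.1 (hsub hx)
          exact Or.inr ⟨x, ⟨by omega, hx⟩, rfl⟩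
    refine ⟨(Finset.range n).filter (· + 1 ∈ T), ?_, hins⟩
    rw [Finset.mem_powersetCard]
    refine ⟨Finset.filter_subset _ _, ?_⟩
    have := congrArg Finset.card hins
    rw [Finset.card_insert_of_notMem (by simp [s]), Finset.card_map, hcard] at this
    omega
  · intro T hT
    rw [Finset.mem_powersetCard] at hT
    have c₁ : ∀ j, countBelow (insert 0 (T.map s)) (j + 1) = countBelow T j + 1 := by
      intro j
      have : (insert 0 (T.map s)).filter (· < j + 1) = insert 0 ((T.filter (· < j)).map s) := by
        ext x
        simp only [Finset.mem_filter, Finset.mem_insert, Finset.mem_map, s]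
        constructor
        · rintro ⟨rfl | ⟨y, hy, rfl⟩, hx⟩
          · exact Or.inl rfl
          · exact Or.inr ⟨y, ⟨hy, by simpa using hx⟩, rfl⟩
        · rintro (rfl | ⟨y, ⟨hy, hlt⟩, rfl⟩)
          · exact ⟨Or.inl rfl, by omega⟩
          · exact ⟨Or.inr ⟨y, hy, rfl⟩, by simpa using hlt⟩
      rw [countBelow, this, Finset.card_insert_of_notMem (by simp [s]), Finset.card_map,
        countBelow]
    have c₂ : ∀ j, countBelow (Finset.range (n + 1) \ insert 0 (T.map s)) (j + 1)
        = countBelow (Finset.range n \ T) j := by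
      intro j
      have : (Finset.range (n + 1) \ insert 0 (T.map s)).filter (· < j + 1)
          = ((Finset.range n \ T).filter (· < j)).map s := by
        ext x
        rcases x with _ | x
        · simp [s]
        · simp [s]
      rw [countBelow, this, Finset.card_map, countBelow]
    have e₁ : SimplexCategory.δ 0 ≫ collapse (insert 0 (T.map s)) (n + 1) (p + 1)
        = collapse T n p ≫ SimplexCategory.δ 0 := by
      refine hom_ext_val fun x => ?_
      rw [comp_apply_toOrderHom, comp_apply_toOrderHom, collapse_apply_val, δ_apply_val,
        δ_apply_val, collapse_apply_val]
      simp [c₁]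
    have e₂ : SimplexCategory.δ 0 ≫
        collapse (Finset.range (n + 1) \ insert 0 (T.map s)) (n + 1) q
        = collapse (Finset.range n \ T) n q := by
      refine hom_ext_val fun x => ?_
      rw [comp_apply_toOrderHom, collapse_apply_val, δ_apply_val, collapse_apply_val]
      simp [c₂]
    have hsum : ∑ x ∈ insert 0 (T.map s), x = (∑ x ∈ T, x) + p := by
      rw [Finset.sum_insert (by simp [s]), Finset.sum_map]
      simp [s, Finset.sum_add_distrib, hT.2]
    rw [e₁, e₂, hsum, smul_smul, ← pow_add, add_comm p, ← map_map_apply]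
    rfl

/-! ### The front and back faces of a shuffle product -/

/-- The inclusion `[p] → [n]` of the first vertices. -/
def frontFace (p n : ℕ) : ⦋p⦌ ⟶ ⦋n⦌ :=
  SimplexCategory.mkHom ⟨fun j => ⟨min j n, by omega⟩, fun _ _ h =>
    Fin.mk_le_mk.2 (min_le_min_right n (Fin.le_def.1 h))⟩

/-- The inclusion `[q] → [n]`, `j ↦ p + j`, where `n` is meant to be `p + q`. -/
def backFace (p q n : ℕ) : ⦋q⦌ ⟶ ⦋n⦌ :=
  SimplexCategory.mkHom ⟨fun j => ⟨min (p + j) n, by omega⟩, fun _ _ h =>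
    Fin.mk_le_mk.2 (min_le_min_right n (Nat.add_le_add_left (Fin.le_def.1 h) p))⟩

lemma frontFace_apply_val (p n : ℕ) (j : Fin (p + 1)) :
    ((frontFace p n).toOrderHom j : ℕ) = min (j : ℕ) n := rfl

lemma backFace_apply_val (p q n : ℕ) (j : Fin (q + 1)) :
    ((backFace p q n).toOrderHom j : ℕ) = min (p + (j : ℕ)) n := rfl

lemma countBelow_range {p j : ℕ} (h : j ≤ p) : countBelow (Finset.range p) j = j := by
  have : (Finset.range p).filter (· < j) = Finset.range j := by
    ext x; simp; omega
  rw [countBelow, this, Finset.card_range]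

lemma countBelow_range_sdiff {p q j : ℕ} (h : j ≤ q) :
    countBelow (Finset.range (p + q) \ Finset.range p) (p + j) = j := by
  have : (Finset.range (p + q) \ Finset.range p).filter (· < p + j) = Finset.Ico p (p + j) := by
    ext x; simp; omega
  rw [countBelow, this, Nat.card_Ico]
  omega

/-- Only the shuffle performing all `p` steps of `a` first survives: for any other `T` the front
face never reaches the last vertex of `[p]`, so it gives a proper face of `a`. -/
theorem sum_front_back_shuffle {p q : ℕ} {a : A _⦋p⦌} (ha : FacesZero a) (b : B _⦋q⦌)
    (φ : A _⦋p⦌ →ₗ[ℚ] ℚ) (ψ : B _⦋q⦌ →ₗ[ℚ] ℚ) (μ : SimplicialBilinear A B C)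
    (Φ : C _⦋p + q⦌ →ₗ[ℚ] ℚ)
    (hΦ : ∀ x y, Φ (μ.app _ x y) = φ ((A.map (frontFace p (p + q)).op).hom x) *
      ψ ((B.map (backFace p q (p + q)).op).hom y)) :
    Φ (shuffle μ (p + q) a b) = (-1 : ℤ) ^ (∑ x ∈ Finset.range p, x) • (φ a * ψ b) := by
  rw [shuffle, map_sum, Finset.sum_eq_single_of_mem (Finset.range p)]
  · have e₁ : frontFace p (p + q) ≫ collapse (Finset.range p) (p + q) p = 𝟙 _ := by
      refine hom_ext_val fun j => ?_
      rw [comp_apply_toOrderHom, collapse_apply_val, frontFace_apply_val]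
      have h : (j : ℕ) ≤ p := Fin.is_le j
      rw [min_eq_left (by omega : (j : ℕ) ≤ p + q), countBelow_range h, min_eq_left h]
      rfl
    have e₂ : backFace p q (p + q) ≫
        collapse (Finset.range (p + q) \ Finset.range p) (p + q) q = 𝟙 _ := by
      refine hom_ext_val fun j => ?_
      rw [comp_apply_toOrderHom, collapse_apply_val, backFace_apply_val]
      have h : (j : ℕ) ≤ q := Fin.is_le j
      rw [min_eq_left (by omega : p + (j : ℕ) ≤ p + q), countBelow_range_sdiff h, min_eq_left h]
      rfl
    rw [map_zsmul, hΦ, map_map_apply, map_map_apply, e₁, e₂]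
    simp
  · rw [Finset.mem_powersetCard]
    exact ⟨Finset.range_subset_range.2 (by omega), Finset.card_range p⟩
  · intro T hT hne
    rw [Finset.mem_powersetCard] at hT
    have hlt : countBelow T p < p := by
      refine lt_of_le_of_ne (hT.2 ▸ countBelow_le_card T p) fun h => hne ?_
      have h1 : T.filter (· < p) = T :=
        Finset.eq_of_subset_of_card_le (Finset.filter_subset _ _) (by rw [hT.2]; exact h.ge)
      refine Finset.eq_of_subset_of_card_le (fun x hx => ?_) (by simp [hT.2])
      rw [← h1, Finset.mem_filter] at hx
      exact Finset.mem_range.2 hx.2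
    rw [map_zsmul, hΦ, map_map_apply, ha _ (Fin.last p)]
    · simp
    · intro x hx
      have hx' := congrArg Fin.val hx
      rw [comp_apply_toOrderHom, collapse_apply_val, frontFace_apply_val] at hx'
      have hx₂ : (x : ℕ) ≤ p := Fin.is_le x
      have := countBelow_mono T (show min (x : ℕ) (p + q) ≤ p by omega)
      simp at hx'
      omega

/-! ### Moore cycles -/

section Moore

open AlgebraicTopology AlgebraicTopology.DoldKan

variable {A B C : SimplicialObject (ModuleCat.{u} ℚ)}

/-- The alternating sum of the faces. -/
noncomputable def altFace (A : SimplicialObject (ModuleCat.{u} ℚ)) (n : ℕ) :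
    A _⦋n + 1⦌ →ₗ[ℚ] A _⦋n⦌ :=
  (AlternatingFaceMapComplex.objD A n).hom

lemma altFace_apply {n : ℕ} (x : A _⦋n + 1⦌) :
    altFace A n x = ∑ i : Fin (n + 2), (-1 : ℤ) ^ (i : ℕ) • (A.δ i).hom x := by
  simp [altFace, AlternatingFaceMapComplex.objD, ModuleCat.hom_sum, LinearMap.sum_apply]

lemma altFace_eq_δ_zero {n : ℕ} {x : A _⦋n + 1⦌}
    (h : ∀ i : Fin (n + 2), i ≠ 0 → (A.δ i).hom x = 0) : altFace A n x = (A.δ 0).hom x := by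
  rw [altFace_apply, Finset.sum_eq_single 0]
  · simp
  · intro i _ hi
    rw [h i hi, smul_zero]
  · simp

/-- The projection onto the Moore complex. -/
noncomputable def mooreProj (A : SimplicialObject (ModuleCat.{u} ℚ)) (n : ℕ) :
    A _⦋n⦌ →ₗ[ℚ] A _⦋n⦌ :=
  ((PInfty : AlternatingFaceMapComplex.obj A ⟶ _).f n).hom

lemma δ_mooreProj {n : ℕ} (x : A _⦋n + 1⦌) {i : Fin (n + 2)} (hi : i ≠ 0) :
    (A.δ i).hom (mooreProj A (n + 1) x) = 0 := by
  obtain ⟨j, rfl⟩ := Fin.exists_succ_eq.2 hi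
  have h := HigherFacesVanish.of_P (X := A) (n + 1) n j (by omega)
  exact LinearMap.congr_fun (congrArg ModuleCat.Hom.hom h) x

lemma altFace_mooreProj {n : ℕ} (x : A _⦋n + 1⦌) :
    altFace A n (mooreProj A (n + 1) x) = mooreProj A n (altFace A n x) := by
  have h := (PInfty : AlternatingFaceMapComplex.obj A ⟶ _).comm (n + 1) n
  have e : (AlternatingFaceMapComplex.obj A).d (n + 1) n = AlternatingFaceMapComplex.objD A n :=
    AlternatingFaceMapComplex.obj_d_eq A n
  rw [e] at h
  exact LinearMap.congr_fun (congrArg ModuleCat.Hom.hom h) x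

lemma mooreProj_naturality (f : A ⟶ B) {n : ℕ} (x : A _⦋n⦌) :
    mooreProj B n ((f.app (op ⦋n⦌)).hom x) = (f.app (op ⦋n⦌)).hom (mooreProj A n x) :=
  LinearMap.congr_fun (congrArg ModuleCat.Hom.hom (PInfty_f_naturality n f)) x

lemma mooreProj_map_eq_zero {n k : ℕ} (g : ⦋n⦌ ⟶ ⦋k⦌) (hg : ¬ Mono g) (x : A _⦋k⦌) :
    mooreProj A n ((A.map g.op).hom x) = 0 :=
  LinearMap.congr_fun (congrArg ModuleCat.Hom.hom (degeneracy_comp_PInfty A n g hg)) x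

lemma exists_altFace_eq_mooreProj_sub {n : ℕ} (x : A _⦋n + 1⦌) (hx : altFace A n x = 0) :
    ∃ y, altFace A (n + 1) y = mooreProj A (n + 1) x - x := by
  have h := (homotopyPInftyToId A).comm (n + 1)
  have e : ∀ n, (AlternatingFaceMapComplex.obj A).d (n + 1) n
      = AlternatingFaceMapComplex.objD A n := AlternatingFaceMapComplex.obj_d_eq A
  rw [dNext_eq _ (i' := n) (by simp), prevD_eq _ (j' := n + 2) (by simp), e, e] at h
  have h' := LinearMap.congr_fun (congrArg ModuleCat.Hom.hom h) x
  let s₀ : A _⦋n⦌ →ₗ[ℚ] A _⦋n + 1⦌ := ((homotopyPInftyToId A).hom n (n + 1)).hom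
  let s₁ : A _⦋n + 1⦌ →ₗ[ℚ] A _⦋n + 2⦌ := ((homotopyPInftyToId A).hom (n + 1) (n + 2)).hom
  refine ⟨s₁ x, ?_⟩
  have h₁ : mooreProj A (n + 1) x = s₀ (altFace A n x) + altFace A (n + 1) (s₁ x) + x := h'
  rw [h₁, hx, map_zero]
  abel

/-- On the Moore complex the differential is the face `0` alone, so a cycle there loses that face as
well. -/
lemma facesZero_mooreProj {n : ℕ} {x : A _⦋n + 1⦌} (hx : altFace A n x = 0) :
    FacesZero (mooreProj A (n + 1) x) := by
  refine facesZero_of_δ fun v => ?_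
  by_cases hv : v = 0
  · rw [hv, ← altFace_eq_δ_zero fun i hi => δ_mooreProj x hi, altFace_mooreProj, hx, map_zero]
  · exact δ_mooreProj x hv

lemma shuffle_zero_left (μ : SimplicialBilinear A B C) {p q n : ℕ} (b : B _⦋q⦌) :
    shuffle μ n (0 : A _⦋p⦌) b = 0 := by
  simp [shuffle]

theorem altFace_shuffle_eq_zero (μ : SimplicialBilinear A B C) {p q n : ℕ} (hn : n = p + q)
    {a : A _⦋p + 1⦌} {b : B _⦋q⦌} (ha : FacesZero a) (hb : FacesZero b) :
    altFace C n (shuffle μ (n + 1) a b) = 0 := by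
  rw [altFace_eq_δ_zero fun i hi =>
    δ_shuffle_of_ne_zero μ (by omega) ha.higherFacesZero hb.higherFacesZero hi,
    δ_zero_shuffle μ hn hb]
  have : (A.δ 0).hom a = 0 := ha (SimplexCategory.δ 0) 0 fun x => Fin.succAbove_ne 0 x
  rw [this, shuffle_zero_left, smul_zero]

/-- The shuffle of the normalized `w` with `b` has only the face `0`, which is the required product
up to `(-1)^p`. -/
theorem exists_altFace_eq_shuffle (μ : SimplicialBilinear A B C) {p q n : ℕ} (hn : n = p + q)
    (w : A _⦋p + 1⦌) {b : B _⦋q⦌} (hb : FacesZero b) :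
    ∃ W, altFace C n W = shuffle μ n (mooreProj A p (altFace A p w)) b := by
  refine ⟨(-1 : ℤ) ^ p • shuffle μ (n + 1) (mooreProj A (p + 1) w) b, ?_⟩
  rw [map_zsmul, altFace_eq_δ_zero fun i hi => δ_shuffle_of_ne_zero μ (by omega)
    (higherFacesZero_of_δ fun v hv => δ_mooreProj w hv) hb.higherFacesZero hi,
    δ_zero_shuffle μ hn hb, smul_smul, ← mul_pow, ← altFace_mooreProj,
    altFace_eq_δ_zero fun i hi => δ_mooreProj w hi]
  simp

/-- Compatibility of the Alexander–Whitney pairing of two cocycles with the differential. -/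
theorem sum_front_back_eq_zero {p q : ℕ} (φ : A _⦋p⦌ →ₗ[ℚ] ℚ) (ψ : B _⦋q⦌ →ₗ[ℚ] ℚ)
    (hφ : ∀ x, φ (altFace A p x) = 0) (hψ : ∀ x, ψ (altFace B q x) = 0)
    (s : A _⦋p + q + 1⦌) (t : B _⦋p + q + 1⦌) :
    ∑ i : Fin (p + q + 2), (-1 : ℤ) ^ (i : ℕ) •
      (φ ((A.map (frontFace p (p + q)).op).hom ((A.δ i).hom s)) *
        ψ ((B.map (backFace p q (p + q)).op).hom ((B.δ i).hom t))) = 0 := by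
  set s₁ := (A.map (frontFace (p + 1) (p + q + 1)).op).hom s with hs₁
  set t₁ := (B.map (backFace p (q + 1) (p + q + 1)).op).hom t with ht₁
  -- `X` and `Y` are the values of the cocycles on the faces of the front `(p+1)`-face and the back
  -- `(q+1)`-face. Padding by zero allows sums over `Finset.range`.
  let X : ℕ → ℚ := fun i => if h : i < p + 2 then φ ((A.δ ⟨i, h⟩).hom s₁) else 0
  let Y : ℕ → ℚ := fun j => if h : j < q + 2 then ψ ((B.δ ⟨j, h⟩).hom t₁) else 0
  have hX : ∑ i ∈ Finset.range (p + 2), (-1 : ℚ) ^ i * X i = 0 := by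
    rw [← hφ s₁, altFace_apply, map_sum, ← Fin.sum_univ_eq_sum_range fun i => (-1 : ℚ) ^ i * X i]
    refine Finset.sum_congr rfl fun i _ => ?_
    simp [X]
  have hY : ∑ i ∈ Finset.range (q + 2), (-1 : ℚ) ^ i * Y i = 0 := by
    rw [← hψ t₁, altFace_apply, map_sum, ← Fin.sum_univ_eq_sum_range fun i => (-1 : ℚ) ^ i * Y i]
    refine Finset.sum_congr rfl fun i _ => ?_
    simp [Y]
  -- For `i > p` the front factor is always the last face of `s₁`; dually, for `i ≤ p` the truncated
  -- `i - p` selects face `0` of `t₁`.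
  have fA : ∀ i : Fin (p + q + 2), φ ((A.map (frontFace p (p + q)).op).hom ((A.δ i).hom s)) =
      X (min i (p + 1)) := by
    intro i
    simp only [X]
    rw [dif_pos (by omega)]
    change φ ((A.map _).hom ((A.map (SimplexCategory.δ i).op).hom s)) =
      φ ((A.map (SimplexCategory.δ _).op).hom s₁)
    rw [hs₁, map_map_apply, map_map_apply]
    congr 5
    refine hom_ext_val fun x => ?_
    have hx : (x : ℕ) ≤ p := Fin.is_le x
    rw [comp_apply_toOrderHom, comp_apply_toOrderHom, δ_apply_val, frontFace_apply_val,
      frontFace_apply_val, δ_apply_val]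
    simp only
    split_ifs <;> omega
  have fB : ∀ i : Fin (p + q + 2), ψ ((B.map (backFace p q (p + q)).op).hom ((B.δ i).hom t)) =
      Y ((i : ℕ) - p) := by
    intro i
    simp only [Y]
    rw [dif_pos (by omega)]
    change ψ ((B.map _).hom ((B.map (SimplexCategory.δ i).op).hom t)) =
      ψ ((B.map (SimplexCategory.δ _).op).hom t₁)
    rw [ht₁, map_map_apply, map_map_apply]
    congr 5
    refine hom_ext_val fun x => ?_
    have hx : (x : ℕ) ≤ q := Fin.is_le x
    rw [comp_apply_toOrderHom, comp_apply_toOrderHom, δ_apply_val, backFace_apply_val,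
      backFace_apply_val, δ_apply_val]
    simp only
    split_ifs <;> omega
  simp only [fA, fB]
  have cv : ∀ i : Fin (p + q + 2), (-1 : ℤ) ^ (i : ℕ) • (X (min i (p + 1)) * Y ((i : ℕ) - p)) =
      (fun i : ℕ => (-1 : ℚ) ^ i * (X (min i (p + 1)) * Y (i - p))) i := by
    intro i; simp
  rw [Finset.sum_congr rfl fun i _ => cv i,
    Fin.sum_univ_eq_sum_range fun i => (-1 : ℚ) ^ i * (X (min i (p + 1)) * Y (i - p)),
    show p + q + 2 = (p + 1) + (q + 1) by ring, Finset.sum_range_add]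
  have e₁ : ∑ i ∈ Finset.range (p + 1), (-1 : ℚ) ^ i * (X (min i (p + 1)) * Y (i - p)) =
      (∑ i ∈ Finset.range (p + 1), (-1 : ℚ) ^ i * X i) * Y 0 := by
    rw [Finset.sum_mul]
    refine Finset.sum_congr rfl fun i hi => ?_
    have := Finset.mem_range.1 hi
    rw [min_eq_left (by omega), show i - p = 0 by omega, mul_assoc]
  have e₂ : ∑ i ∈ Finset.range (q + 1),
      (-1 : ℚ) ^ (p + 1 + i) * (X (min (p + 1 + i) (p + 1)) * Y (p + 1 + i - p)) =
      (-1) ^ p * X (p + 1) * ∑ i ∈ Finset.range (q + 1), (-1 : ℚ) ^ (i + 1) * Y (i + 1) := by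
    rw [Finset.mul_sum]
    refine Finset.sum_congr rfl fun i hi => ?_
    rw [min_eq_right (by omega), show p + 1 + i - p = i + 1 by omega]
    ring
  rw [e₁, e₂]
  rw [Finset.sum_range_succ] at hX
  rw [Finset.sum_range_succ'] at hY
  -- The cocycle conditions reduce both blocks to `±(-1)^p * X (p + 1) * Y 0`, with opposite signs.
  have hX' : ∑ i ∈ Finset.range (p + 1), (-1 : ℚ) ^ i * X i = (-1) ^ p * X (p + 1) := by
    rw [pow_succ] at hX; linarith
  have hY' : ∑ i ∈ Finset.range (q + 1), (-1 : ℚ) ^ (i + 1) * Y (i + 1) = - Y 0 := by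
    simp only [pow_zero, one_mul] at hY; linarith
  rw [hX', hY']
  ring

end Moore

/-! ### Free simplicial modules -/

section Free

open Limits

/-- The functor `T ↦ ⨁_T ℚ` used for singular chains. -/
noncomputable abbrev freeFunctor : Type u ⥤ ModuleCat.{u} ℚ :=
  sigmaConst.obj (ModuleCat.of ℚ (ULift.{u} ℚ))

/-- The generator attached to `t`. -/
noncomputable def gen {T : Type u} (t : T) : freeFunctor.obj T :=
  (Sigma.ι (fun _ : T => ModuleCat.of ℚ (ULift.{u} ℚ)) t).hom ⟨1⟩

lemma free_hom_ext {T : Type u} {M : ModuleCat.{u} ℚ} {f g : freeFunctor.obj T ⟶ M}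
    (h : ∀ t, f.hom (gen t) = g.hom (gen t)) : f = g := by
  refine Sigma.hom_ext _ _ fun t => ?_
  ext ⟨x⟩
  have key : ∀ k : freeFunctor.obj T ⟶ M,
      (Sigma.ι (fun _ : T => ModuleCat.of ℚ (ULift.{u} ℚ)) t ≫ k).hom ⟨x⟩ =
        x • k.hom (gen t) := by
    intro k
    rw [gen, ← map_smul, ← map_smul]
    have : (ULift.up x : ULift.{u} ℚ) = x • (ULift.up 1 : ULift.{u} ℚ) := by
      ext; simp
    change k.hom ((Sigma.ι (fun _ : T => ModuleCat.of ℚ (ULift.{u} ℚ)) t).hom _) = _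
    rw [this]
  rw [key, key, h]

/-- The isomorphism with finitely supported functions, as a linear map. -/
noncomputable def freeToFinsupp (T : Type u) : freeFunctor.obj T ⟶ ModuleCat.of ℚ (T →₀ ℚ) :=
  Sigma.desc fun t =>
    ModuleCat.ofHom ((Finsupp.lsingle t).comp (ULift.moduleEquiv (R := ℚ) (M := ℚ)).toLinearMap)

lemma freeToFinsupp_gen {T : Type u} (t : T) :
    (freeToFinsupp T).hom (gen t) = Finsupp.single t 1 := by
  have h := Sigma.ι_desc (fun t : T => ModuleCat.ofHom
    ((Finsupp.lsingle t).comp (ULift.moduleEquiv (R := ℚ) (M := ℚ)).toLinearMap)) t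
  exact LinearMap.congr_fun (congrArg ModuleCat.Hom.hom h) ⟨1⟩

/-- The generators form a basis. -/
noncomputable def freeBasis (T : Type u) : Module.Basis T ℚ (freeFunctor.obj T) :=
  .ofRepr <| LinearEquiv.ofLinearMap (freeToFinsupp T).hom
    (Finsupp.linearCombination ℚ gen)
    (by
      refine Finsupp.lhom_ext' fun t => LinearMap.ext_ring ?_
      simpa using freeToFinsupp_gen t)
    (by
      have : freeToFinsupp T ≫ ModuleCat.ofHom (Finsupp.linearCombination ℚ gen) = 𝟙 _ :=
        free_hom_ext fun t => by
          have := congrArg (Finsupp.linearCombination ℚ gen) (freeToFinsupp_gen t)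
          simpa using this
      exact congrArg ModuleCat.Hom.hom this)

@[simp] lemma freeBasis_apply {T : Type u} (t : T) : freeBasis T t = gen t := by
  simp [freeBasis, Module.Basis.coe_ofRepr]

lemma freeFunctor_map_gen {T T' : Type u} (g : T ⟶ T') (t : T) :
    (freeFunctor.map g).hom (gen t) = gen (g t) := by
  have h : Sigma.ι (fun _ : T => ModuleCat.of ℚ (ULift.{u} ℚ)) t ≫ freeFunctor.map g =
      Sigma.ι (fun _ : T' => ModuleCat.of ℚ (ULift.{u} ℚ)) (g t) := by
    simp [freeFunctor]
  exact LinearMap.congr_fun (congrArg ModuleCat.Hom.hom h) ⟨1⟩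

/-- The free simplicial `ℚ`-module on a simplicial set. -/
noncomputable abbrev chains (S : SSet.{u}) : SimplicialObject (ModuleCat.{u} ℚ) :=
  ((SimplicialObject.whiskering _ _).obj freeFunctor).obj S

/-- The map induced on free simplicial modules. -/
noncomputable abbrev chainsMap {S T : SSet.{u}} (f : S ⟶ T) : chains S ⟶ chains T :=
  ((SimplicialObject.whiskering _ _).obj freeFunctor).map f

/-- The generator attached to a simplex. -/
noncomputable def simplexGen {S : SSet.{u}} {n : ℕ} (σ : S _⦋n⦌) : (chains S) _⦋n⦌ :=
  (gen σ : freeFunctor.obj (S _⦋n⦌))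

/-- The basis of simplices. -/
noncomputable def simplexBasis (S : SSet.{u}) (n : ℕ) :
    Module.Basis (S _⦋n⦌) ℚ ((chains S) _⦋n⦌) :=
  freeBasis (S _⦋n⦌)

@[simp] lemma simplexBasis_apply {S : SSet.{u}} {n : ℕ} (σ : S _⦋n⦌) :
    simplexBasis S n σ = simplexGen σ :=
  freeBasis_apply σ

lemma constr_simplexGen {S : SSet.{u}} {n : ℕ} {M : Type*} [AddCommGroup M] [Module ℚ M]
    (f : S _⦋n⦌ → M) (σ : S _⦋n⦌) : (simplexBasis S n).constr ℚ f (simplexGen σ) = f σ := by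
  rw [← simplexBasis_apply, Module.Basis.constr_basis]

lemma chains_map_gen {S : SSet.{u}} {n m : ℕ} (g : ⦋n⦌ ⟶ ⦋m⦌) (σ : S _⦋m⦌) :
    ((chains S).map g.op).hom (simplexGen σ) = simplexGen (S.map g.op σ) :=
  freeFunctor_map_gen _ _

lemma chainsMap_gen {S T : SSet.{u}} (f : S ⟶ T) {n : ℕ} (σ : S _⦋n⦌) :
    ((chainsMap f).app (op ⦋n⦌)).hom (simplexGen σ) = simplexGen (f.app (op ⦋n⦌) σ) :=
  freeFunctor_map_gen _ _

end Free

/-! ### Pairings of simplicial sets and Alexander–Whitney functionals -/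

section Pairing

variable {S T U S' T' U' : SSet.{u}}

/-- A simplicial map `S × T → U`. -/
structure SimplicialPairing (S T U : SSet.{u}) where
  /-- the map in each degree -/
  app (n : ℕ) : S _⦋n⦌ → T _⦋n⦌ → U _⦋n⦌
  naturality {n m : ℕ} (g : ⦋n⦌ ⟶ ⦋m⦌) (σ : S _⦋m⦌) (τ : T _⦋m⦌) :
    U.map g.op (app m σ τ) = app n (S.map g.op σ) (T.map g.op τ)

/-- The bilinear extension in degree `n`. -/
noncomputable def SimplicialPairing.lin (θ : SimplicialPairing S T U) (n : ℕ) :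
    (chains S) _⦋n⦌ →ₗ[ℚ] (chains T) _⦋n⦌ →ₗ[ℚ] (chains U) _⦋n⦌ :=
  (simplexBasis S n).constr ℚ fun σ => (simplexBasis T n).constr ℚ fun τ =>
    simplexGen (θ.app n σ τ)

lemma SimplicialPairing.lin_gen (θ : SimplicialPairing S T U) {n : ℕ} (σ : S _⦋n⦌)
    (τ : T _⦋n⦌) : θ.lin n (simplexGen σ) (simplexGen τ) = simplexGen (θ.app n σ τ) := by
  rw [SimplicialPairing.lin, constr_simplexGen, constr_simplexGen]

lemma chains_bilin_ext {n : ℕ} {M : Type*} [AddCommGroup M] [Module ℚ M]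
    {f g : (chains S) _⦋n⦌ →ₗ[ℚ] (chains T) _⦋n⦌ →ₗ[ℚ] M}
    (h : ∀ (σ : S _⦋n⦌) (τ : T _⦋n⦌), f (simplexGen σ) (simplexGen τ) =
      g (simplexGen σ) (simplexGen τ)) : f = g := by
  refine (simplexBasis S n).ext fun σ => (simplexBasis T n).ext fun τ => ?_
  rw [simplexBasis_apply, simplexBasis_apply]
  exact h σ τ

/-- The bilinear extension of a pairing. -/
noncomputable def SimplicialPairing.bilinear (θ : SimplicialPairing S T U) :
    SimplicialBilinear (chains S) (chains T) (chains U) where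
  app := θ.lin
  naturality {n m} g a b := by
    have : (θ.lin m).compr₂ ((chains U).map g.op).hom =
        (θ.lin n).compl₁₂ ((chains S).map g.op).hom ((chains T).map g.op).hom := by
      refine chains_bilin_ext fun σ τ => ?_
      rw [LinearMap.compr₂_apply, LinearMap.compl₁₂_apply, chains_map_gen, chains_map_gen,
        θ.lin_gen, θ.lin_gen, ← θ.naturality, chains_map_gen]
    exact LinearMap.congr_fun₂ this a b

lemma SimplicialPairing.map_bilinear (θ : SimplicialPairing S T U)
    (θ' : SimplicialPairing S' T' U') (f : S ⟶ S') (g : T ⟶ T') (h : U ⟶ U')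
    (H : ∀ n σ τ, h.app (op ⦋n⦌) (θ.app n σ τ) =
      θ'.app n (f.app (op ⦋n⦌) σ) (g.app (op ⦋n⦌) τ)) {n : ℕ}
    (a : (chains S) _⦋n⦌) (b : (chains T) _⦋n⦌) :
    ((chainsMap h).app (op ⦋n⦌)).hom (θ.bilinear.app n a b) =
      θ'.bilinear.app n (((chainsMap f).app (op ⦋n⦌)).hom a)
        (((chainsMap g).app (op ⦋n⦌)).hom b) := by
  have : (θ.lin n).compr₂ ((chainsMap h).app (op ⦋n⦌)).hom =
      (θ'.lin n).compl₁₂ ((chainsMap f).app (op ⦋n⦌)).hom ((chainsMap g).app (op ⦋n⦌)).hom := by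
    refine chains_bilin_ext fun σ τ => ?_
    rw [LinearMap.compr₂_apply, LinearMap.compl₁₂_apply, chainsMap_gen, chainsMap_gen,
      θ.lin_gen, θ'.lin_gen, ← H, chainsMap_gen]
  exact LinearMap.congr_fun₂ this a b

lemma map_shuffle_naturality {A B C A' B' C' : SimplicialObject (ModuleCat.{u} ℚ)}
    (μ : SimplicialBilinear A B C) (μ' : SimplicialBilinear A' B' C') (f : A ⟶ A') (g : B ⟶ B')
    (h : C ⟶ C') (H : ∀ n a b, (h.app (op ⦋n⦌)).hom (μ.app n a b) =
      μ'.app n ((f.app (op ⦋n⦌)).hom a) ((g.app (op ⦋n⦌)).hom b)) {p q n : ℕ}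
    (a : A _⦋p⦌) (b : B _⦋q⦌) :
    (h.app (op ⦋n⦌)).hom (shuffle μ n a b) =
      shuffle μ' n ((f.app (op ⦋p⦌)).hom a) ((g.app (op ⦋q⦌)).hom b) := by
  have nat : ∀ {A A' : SimplicialObject (ModuleCat.{u} ℚ)} (f : A ⟶ A') {n m : ℕ}
      (k : ⦋n⦌ ⟶ ⦋m⦌) (x : A _⦋m⦌), (f.app (op ⦋n⦌)).hom ((A.map k.op).hom x) =
        (A'.map k.op).hom ((f.app (op ⦋m⦌)).hom x) := fun f _ _ k x =>
    LinearMap.congr_fun (congrArg ModuleCat.Hom.hom (f.naturality k.op)) x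
  rw [shuffle, shuffle, map_sum]
  refine Finset.sum_congr rfl fun T _ => ?_
  rw [map_zsmul, H, nat, nat]

variable {p q : ℕ}

/-- The functional `φ ⊠ ψ` on chains of `U`, given maps `α : U → S` and `β : U → T`. -/
noncomputable def alexanderWhitney (α : U ⟶ S) (β : U ⟶ T)
    (φ : (chains S) _⦋p⦌ →ₗ[ℚ] ℚ) (ψ : (chains T) _⦋q⦌ →ₗ[ℚ] ℚ) :
    (chains U) _⦋p + q⦌ →ₗ[ℚ] ℚ :=
  (simplexBasis U (p + q)).constr ℚ fun ρ =>
    φ (((chains S).map (frontFace p (p + q)).op).hom (simplexGen (α.app (op ⦋p + q⦌) ρ))) *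
      ψ (((chains T).map (backFace p q (p + q)).op).hom (simplexGen (β.app (op ⦋p + q⦌) ρ)))

lemma alexanderWhitney_gen (α : U ⟶ S) (β : U ⟶ T)
    (φ : (chains S) _⦋p⦌ →ₗ[ℚ] ℚ) (ψ : (chains T) _⦋q⦌ →ₗ[ℚ] ℚ) (ρ : U _⦋p + q⦌) :
    alexanderWhitney α β φ ψ (simplexGen ρ) =
      φ (((chains S).map (frontFace p (p + q)).op).hom (simplexGen (α.app (op ⦋p + q⦌) ρ))) *
      ψ (((chains T).map (backFace p q (p + q)).op).hom
        (simplexGen (β.app (op ⦋p + q⦌) ρ))) := by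
  rw [alexanderWhitney, constr_simplexGen]

/-- On a single simplex this is the cocycle identity `sum_front_back_eq_zero`, applied to its images
under `α` and `β`. -/
theorem alexanderWhitney_altFace (α : U ⟶ S) (β : U ⟶ T)
    (φ : (chains S) _⦋p⦌ →ₗ[ℚ] ℚ) (ψ : (chains T) _⦋q⦌ →ₗ[ℚ] ℚ)
    (hφ : ∀ x, φ (altFace _ p x) = 0) (hψ : ∀ x, ψ (altFace _ q x) = 0)
    (w : (chains U) _⦋p + q + 1⦌) :
    alexanderWhitney α β φ ψ (altFace _ (p + q) w) = 0 := by
  suffices h : (alexanderWhitney α β φ ψ).comp (altFace (chains U) (p + q)) = 0 from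
    LinearMap.congr_fun h w
  refine (simplexBasis U (p + q + 1)).ext fun ρ => ?_
  rw [simplexBasis_apply, LinearMap.comp_apply, altFace_apply, map_sum, LinearMap.zero_apply,
    ← sum_front_back_eq_zero φ ψ hφ hψ (simplexGen (α.app (op ⦋p + q + 1⦌) ρ))
      (simplexGen (β.app (op ⦋p + q + 1⦌) ρ))]
  refine Finset.sum_congr rfl fun i _ => ?_
  have e : ∀ (V : SSet.{u}) (σ : V _⦋p + q + 1⦌), ((chains V).δ i).hom (simplexGen σ) =
      simplexGen (V.map (SimplexCategory.δ i).op σ) := fun V σ => chains_map_gen _ _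
  rw [map_zsmul, e, e, e, alexanderWhitney_gen, NatTrans.naturality_apply,
    NatTrans.naturality_apply]

theorem alexanderWhitney_bilinear (θ : SimplicialPairing S T U) (α : U ⟶ S) (β : U ⟶ T)
    (φ : (chains S) _⦋p⦌ →ₗ[ℚ] ℚ) (ψ : (chains T) _⦋q⦌ →ₗ[ℚ] ℚ)
    (hα : ∀ σ τ, α.app _ (θ.app (p + q) σ τ) = σ) (hβ : ∀ σ τ, β.app _ (θ.app (p + q) σ τ) = τ)
    (a : (chains S) _⦋p + q⦌) (b : (chains T) _⦋p + q⦌) :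
    alexanderWhitney α β φ ψ (θ.bilinear.app _ a b) =
      φ (((chains S).map (frontFace p (p + q)).op).hom a) *
        ψ (((chains T).map (backFace p q (p + q)).op).hom b) := by
  have : (θ.lin (p + q)).compr₂ (alexanderWhitney α β φ ψ) =
      (LinearMap.mul ℚ ℚ).compl₁₂ (φ.comp ((chains S).map (frontFace p (p + q)).op).hom)
        (ψ.comp ((chains T).map (backFace p q (p + q)).op).hom) := by
    refine chains_bilin_ext fun σ τ => ?_
    rw [LinearMap.compr₂_apply, LinearMap.compl₁₂_apply, θ.lin_gen, alexanderWhitney_gen, hα, hβ]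
    rfl
  exact LinearMap.congr_fun₂ this a b

/-- The functional `φ ⊠ ψ` vanishes on products one of whose components is constant. -/
theorem alexanderWhitney_bilinear_eq_zero {S₀ T₀ : SSet.{u}} (θ : SimplicialPairing S₀ T₀ U)
    (α : U ⟶ S) (β : U ⟶ T) (φ : (chains S) _⦋p⦌ →ₗ[ℚ] ℚ) (ψ : (chains T) _⦋q⦌ →ₗ[ℚ] ℚ)
    (h : (∀ σ τ, φ (((chains S).map (frontFace p (p + q)).op).hom
        (simplexGen (α.app _ (θ.app (p + q) σ τ)))) = 0) ∨
      ∀ σ τ, ψ (((chains T).map (backFace p q (p + q)).op).hom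
        (simplexGen (β.app _ (θ.app (p + q) σ τ)))) = 0)
    (a : (chains S₀) _⦋p + q⦌) (b : (chains T₀) _⦋p + q⦌) :
    alexanderWhitney α β φ ψ (θ.bilinear.app _ a b) = 0 := by
  have : (θ.lin (p + q)).compr₂ (alexanderWhitney α β φ ψ) = 0 := by
    refine chains_bilin_ext fun σ τ => ?_
    rw [LinearMap.compr₂_apply, θ.lin_gen, alexanderWhitney_gen]
    rcases h with h | h
    · rw [h, zero_mul]; rfl
    · rw [h, mul_zero]; rfl
  exact LinearMap.congr_fun₂ this a b

end Pairing

/-! ### Homology classes and cycles -/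

section Homology

open AlgebraicTopology

variable {A B : SimplicialObject (ModuleCat.{u} ℚ)}

/-- The homology of the alternating face map complex. -/
noncomputable abbrev altHomology (A : SimplicialObject (ModuleCat.{u} ℚ)) (n : ℕ) :
    ModuleCat.{u} ℚ :=
  ((alternatingFaceMapComplex _).obj A).homology n

/-- The map induced on homology. -/
noncomputable abbrev altHomologyMap (f : A ⟶ B) (n : ℕ) : altHomology A n ⟶ altHomology B n :=
  HomologicalComplex.homologyMap ((alternatingFaceMapComplex _).map f) n

/-- The set of pairs of a cycle and its homology class. -/
noncomputable def cycleClass (A : SimplicialObject (ModuleCat.{u} ℚ)) (n : ℕ) :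
    Submodule ℚ (A _⦋n⦌ × altHomology A n) :=
  LinearMap.range (LinearMap.prod
    (((alternatingFaceMapComplex _).obj A).iCycles n).hom
    (((alternatingFaceMapComplex _).obj A).homologyπ n).hom)

lemma altComplex_d (n : ℕ) :
    (((alternatingFaceMapComplex _).obj A).d (n + 1) n).hom = altFace A n :=
  congrArg ModuleCat.Hom.hom (alternatingFaceMapComplex_obj_d A n)

lemma exists_cycleClass {n : ℕ} (h : altHomology A n) : ∃ x, (x, h) ∈ cycleClass A n := by
  obtain ⟨c, hc⟩ := (ModuleCat.epi_iff_surjective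
    (((alternatingFaceMapComplex _).obj A).homologyπ n)).1 inferInstance h
  exact ⟨_, c, Prod.ext rfl hc⟩

lemma exists_class_of_cycle {n : ℕ} {x : A _⦋n + 1⦌} (hx : altFace A n x = 0) :
    ∃ h, (x, h) ∈ cycleClass A (n + 1) := by
  let K := (alternatingFaceMapComplex _).obj A
  let k : ModuleCat.of ℚ (LinearMap.ker (altFace A n)) ⟶ K.X (n + 1) :=
    ModuleCat.ofHom (LinearMap.ker (altFace A n)).subtype
  have hk : k ≫ K.d (n + 1) n = 0 := by
    ext y
    exact (LinearMap.congr_fun (altComplex_d n) _).trans y.2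
  refine ⟨_, (K.liftCycles k n (by simp) hk).hom ⟨x, hx⟩, Prod.ext ?_ rfl⟩
  exact LinearMap.congr_fun (congrArg ModuleCat.Hom.hom (K.liftCycles_i k n (by simp) hk)) ⟨x, hx⟩

lemma cycleClass.altFace_eq_zero {n : ℕ} {x : A _⦋n + 1⦌} {h : altHomology A (n + 1)}
    (H : (x, h) ∈ cycleClass A (n + 1)) : altFace A n x = 0 := by
  obtain ⟨c, hc⟩ := H
  obtain rfl := congrArg Prod.fst hc
  rw [← altComplex_d]
  exact LinearMap.congr_fun (congrArg ModuleCat.Hom.hom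
    (((alternatingFaceMapComplex _).obj A).iCycles_d (n + 1) n)) c

/-- Homology is the cokernel of the map from chains to cycles, and cycles inject into chains. -/
lemma cycleClass.eq_zero_iff {n : ℕ} {x : A _⦋n⦌} {h : altHomology A n}
    (H : (x, h) ∈ cycleClass A n) : h = 0 ↔ ∃ w, altFace A n w = x := by
  let K := (alternatingFaceMapComplex _).obj A
  obtain ⟨c, hc⟩ := H
  obtain rfl := congrArg Prod.fst hc
  obtain rfl := congrArg Prod.snd hc
  have hti : ∀ w, (K.iCycles n).hom ((K.toCycles (n + 1) n).hom w) = altFace A n w := fun w => by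
    rw [← altComplex_d]
    exact LinearMap.congr_fun (congrArg ModuleCat.Hom.hom (K.toCycles_i (n + 1) n)) w
  constructor
  · intro h0
    have ex := ShortComplex.exact_of_g_is_cokernel
      (ShortComplex.mk _ _ (K.toCycles_comp_homologyπ (n + 1) n))
      (K.homologyIsCokernel (n + 1) n (by simp))
    obtain ⟨w, hw⟩ := (ShortComplex.moduleCat_exact_iff _).1 ex c h0
    exact ⟨w, (hti w).symm.trans (congrArg (K.iCycles n).hom hw)⟩
  · rintro ⟨w, hw⟩
    have inj := (ModuleCat.mono_iff_injective (K.iCycles n)).1 inferInstance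
    have : c = (K.toCycles (n + 1) n).hom w := inj (hw.symm.trans (hti w).symm)
    change (K.homologyπ n).hom c = 0
    rw [this]
    exact LinearMap.congr_fun (congrArg ModuleCat.Hom.hom
      (K.toCycles_comp_homologyπ (n + 1) n)) w

lemma cycleClass.map {n : ℕ} {x : A _⦋n⦌} {h : altHomology A n}
    (H : (x, h) ∈ cycleClass A n) (f : A ⟶ B) :
    ((f.app (op ⦋n⦌)).hom x, (altHomologyMap f n).hom h) ∈ cycleClass B n := by
  obtain ⟨c, hc⟩ := H
  obtain rfl := congrArg Prod.fst hc
  obtain rfl := congrArg Prod.snd hc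
  let φ := (alternatingFaceMapComplex _).map f
  refine ⟨(HomologicalComplex.cyclesMap φ n).hom c, Prod.ext ?_ ?_⟩
  · exact LinearMap.congr_fun (congrArg ModuleCat.Hom.hom (HomologicalComplex.cyclesMap_i φ n)) c
  · exact (LinearMap.congr_fun (congrArg ModuleCat.Hom.hom
      (HomologicalComplex.homologyπ_naturality φ n)) c).symm

end Homology

/-! ### Products in the singular simplicial set of a power -/

section Singular

variable {X Y : Type u} [TopologicalSpace X] [TopologicalSpace Y]

/-- The singular simplicial set of `X`. -/
noncomputable abbrev sing (X : Type u) [TopologicalSpace X] : SSet.{u} :=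
  TopCat.toSSet.obj (TopCat.of X)

/-- The map of singular simplicial sets induced by `f`. -/
noncomputable abbrev singMap (f : C(X, Y)) : sing X ⟶ sing Y :=
  TopCat.toSSet.map (TopCat.ofHom f)

/-- A continuous map from the standard simplex as a singular simplex. -/
noncomputable def toSing {n : ℕ} (s : C(SimplexCategory.toTop.{u}.obj ⦋n⦌, X)) : (sing X) _⦋n⦌ :=
  ULift.up (TopCat.ofHom s)

/-- The continuous map underlying a singular simplex. -/
noncomputable def ofSing {n : ℕ} (σ : (sing X) _⦋n⦌) : C(SimplexCategory.toTop.{u}.obj ⦋n⦌, X) :=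
  (ULift.down σ).hom

lemma toSing_ofSing {n : ℕ} (σ : (sing X) _⦋n⦌) : toSing (ofSing σ) = σ := rfl

lemma singMap_toSing (f : C(X, Y)) {n : ℕ} (s : C(SimplexCategory.toTop.{u}.obj ⦋n⦌, X)) :
    (singMap f).app (op ⦋n⦌) (toSing s) = toSing (f.comp s) := rfl

/-- The map `X × X → X^n` onto the coordinates `i` and `j`, the others being `x₀`. -/
def twoCoords (x₀ : X) {n : ℕ} (i j : Fin n) : C(X × X, Fin n → X) :=
  ⟨fun z l => if l = i then z.1 else if l = j then z.2 else x₀, by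
    refine continuous_pi fun l => ?_
    split_ifs <;> fun_prop⟩

/-- The pairing `Sing X × Sing X → Sing (X^n)` onto the coordinates `i` and `j`. -/
noncomputable def coordPairing (x₀ : X) {n : ℕ} (i j : Fin n) :
    SimplicialPairing (sing X) (sing X) (sing (Fin n → X)) where
  app _ σ τ := toSing ((twoCoords x₀ i j).comp ((ofSing σ).prodMk (ofSing τ)))
  naturality _ _ _ := rfl

/-- Evaluation at a coordinate. -/
def coord (X : Type u) [TopologicalSpace X] {n : ℕ} (k : Fin n) : C(Fin n → X, X) :=
  ⟨fun z => z k, by fun_prop⟩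

lemma coord_coordPairing_left (x₀ : X) {n : ℕ} (i j : Fin n) {d : ℕ} (σ τ : (sing X) _⦋d⦌) :
    (singMap (coord X i)).app _ ((coordPairing x₀ i j).app d σ τ) = σ := by
  rw [coordPairing, singMap_toSing, ← toSing_ofSing σ]
  congr 1
  ext t
  simp [coord, twoCoords, toSing_ofSing]

lemma coord_coordPairing_right (x₀ : X) {n : ℕ} {i j : Fin n} (h : j ≠ i) {d : ℕ}
    (σ τ : (sing X) _⦋d⦌) :
    (singMap (coord X j)).app _ ((coordPairing x₀ i j).app d σ τ) = τ := by
  rw [coordPairing, singMap_toSing, ← toSing_ofSing τ]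
  congr 1
  ext t
  simp [coord, twoCoords, toSing_ofSing, h]

lemma coord_coordPairing_of_ne (x₀ : X) {n : ℕ} {i j k : Fin n} (hi : k ≠ i) (hj : k ≠ j) {d : ℕ}
    (σ τ : (sing X) _⦋d⦌) :
    (singMap (coord X k)).app _ ((coordPairing x₀ i j).app d σ τ) =
      toSing (ContinuousMap.const _ x₀) := by
  rw [coordPairing, singMap_toSing]
  congr 1
  ext t
  simp [coord, twoCoords, hi, hj]

lemma powMap_coordPairing (f : C(X, Y)) (x₀ : X) {n : ℕ} (i j : Fin n) {d : ℕ}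
    (σ τ : (sing X) _⦋d⦌) :
    (singMap (powMap f n)).app _ ((coordPairing x₀ i j).app d σ τ) =
      (coordPairing (f x₀) i j).app d ((singMap f).app _ σ) ((singMap f).app _ τ) := by
  change toSing _ = toSing _
  congr 1
  ext t l
  change f (if l = i then _ else if l = j then _ else x₀) =
    if l = i then _ else if l = j then _ else f x₀
  split_ifs <;> rfl

lemma not_mono_to_zero {m : ℕ} (g : ⦋m + 1⦌ ⟶ ⦋0⦌) : ¬ Mono g := by
  rw [SimplexCategory.mono_iff_injective]
  intro h
  have : (0 : Fin (m + 2)) = Fin.last _ := h (Subsingleton.elim (α := Fin 1) _ _)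
  simpa using congrArg Fin.val this

lemma mooreProj_const (x₀ : X) {m d : ℕ} (g : ⦋m + 1⦌ ⟶ ⦋d⦌) :
    mooreProj (chains (sing X)) (m + 1) (((chains (sing X)).map g.op).hom
      (simplexGen (toSing (ContinuousMap.const _ x₀)))) = 0 := by
  -- A constant simplex is pulled back from a point; a map from `[m + 1]` to `[0]` is not mono, so
  -- normalization kills the pullback.
  let g₀ : ⦋d⦌ ⟶ ⦋0⦌ := SimplexCategory.const _ _ 0
  have h : (toSing (ContinuousMap.const _ x₀) : (sing X) _⦋d⦌) =
      (sing X).map g₀.op (toSing (ContinuousMap.const _ x₀)) := rfl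
  rw [h, ← chains_map_gen, map_map_apply]
  exact mooreProj_map_eq_zero _ (not_mono_to_zero _) _

lemma mooreProj_mooreProj {A : SimplicialObject (ModuleCat.{u} ℚ)} {n : ℕ} (x : A _⦋n⦌) :
    mooreProj A n (mooreProj A n x) = mooreProj A n x :=
  LinearMap.congr_fun (congrArg ModuleCat.Hom.hom
    (AlgebraicTopology.DoldKan.PInfty_f_idem (X := A) n)) x

/-- A nonzero homology class of positive degree is detected on a Moore cycle by a normalized
cocycle. -/
lemma exists_normalized_cocycle {A : SimplicialObject (ModuleCat.{u} ℚ)} {m : ℕ}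
    {c : A _⦋m + 1⦌} {h : altHomology A (m + 1)} (hc : (c, h) ∈ cycleClass A (m + 1))
    (h0 : h ≠ 0) : ∃ φ : A _⦋m + 1⦌ →ₗ[ℚ] ℚ, (∀ x, φ (altFace A (m + 1) x) = 0) ∧
      (∀ x, mooreProj A (m + 1) x = 0 → φ x = 0) ∧ φ (mooreProj A (m + 1) c) = 1 := by
  have hz : mooreProj A (m + 1) c ∉ LinearMap.range (altFace A (m + 1)) := by
    rintro ⟨w, hw⟩
    -- The normalized cycle is homologous to `c`, so it cannot bound.
    obtain ⟨y, hy⟩ := exists_altFace_eq_mooreProj_sub c (cycleClass.altFace_eq_zero hc)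
    refine h0 ((cycleClass.eq_zero_iff hc).2 ⟨w - y, ?_⟩)
    rw [map_sub, hw, hy]
    abel
  obtain ⟨φ, hφ, hφ'⟩ := Submodule.exists_le_ker_of_notMem hz
  -- Precomposing with the projection makes the functional normalized; it stays a cocycle because
  -- the projection is a chain map.
  refine ⟨(φ (mooreProj A (m + 1) c))⁻¹ • φ.comp (mooreProj A (m + 1)), fun x => ?_,
    fun x hx => ?_, ?_⟩
  · have : φ (mooreProj A (m + 1) (altFace A (m + 1) x)) = 0 := by
      rw [← altFace_mooreProj]
      exact hφ' ⟨_, rfl⟩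
    simp [this]
  · simp [hx]
  · simp [mooreProj_mooreProj, hφ]

lemma card_le_qdim {ι : Type} [Fintype ι] {V : Type*} [AddCommGroup V] [Module ℚ V]
    {v : ι → V} (hv : LinearIndependent ℚ v) : (Fintype.card ι : ℝ≥0∞) ≤ qdim V := by
  have h := hv.cardinal_lift_le_rank
  rw [Cardinal.mk_fintype, Cardinal.lift_natCast, Cardinal.lift_uzero] at h
  have h' := Cardinal.natCast_le_toENat.2 h
  rw [qdim, ← ENat.toENNReal_coe]
  exact ENat.toENNReal_mono h'

/-- The cross products of `h` with itself in coordinates `i < j` lie in the kernel, and their matrix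
of pairings with the functionals `Φ k l` is diagonal with nonzero entries. -/
theorem sum_range_le_qdim_ker (f : C(X, Y)) (x₀ : X) {m : ℕ} {h : rationalHomology (m + 1) X}
    (h0 : h ≠ 0) (hf : rationalHomologyMap (m + 1) f h = 0) (n : ℕ) :
    ((∑ j ∈ Finset.range n, j : ℕ) : ℝ≥0∞) ≤
      qdim (LinearMap.ker (rationalHomologyMap (m + 1 + (m + 1)) (powMap f n))) := by
  let A := chains (sing X)
  let B := chains (sing Y)
  let C := chains (sing (Fin n → X))
  obtain ⟨c, hc⟩ := exists_cycleClass (A := A) h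
  obtain ⟨φ, hφd, hφP, hφz⟩ := exists_normalized_cocycle hc h0
  set z := mooreProj A (m + 1) c with hz
  have hzF : FacesZero z := facesZero_mooreProj (cycleClass.altFace_eq_zero hc)
  let e : Fin n → Fin n → C _⦋m + 1 + (m + 1)⦌ := fun i j =>
    shuffle (coordPairing x₀ i j).bilinear (m + 1 + (m + 1)) z z
  have hcyc : ∀ i j, ∃ k, (e i j, k) ∈ cycleClass C (m + 1 + (m + 1)) := fun i j =>
    exists_class_of_cycle (n := m + 1 + m)
      (altFace_shuffle_eq_zero (coordPairing x₀ i j).bilinear (by omega) hzF hzF)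
  choose κ hκ using hcyc
  -- the classes lie in the kernel
  have hker : ∀ i j, rationalHomologyMap (m + 1 + (m + 1)) (powMap f n) (κ i j) = 0 := by
    intro i j
    refine (cycleClass.eq_zero_iff (cycleClass.map (hκ i j) (chainsMap (singMap (powMap f n))))).2 ?_
    obtain ⟨w, hw⟩ := (cycleClass.eq_zero_iff (cycleClass.map hc (chainsMap (singMap f)))).1 hf
    have hfz : ((chainsMap (singMap f)).app (op ⦋m + 1⦌)).hom z =
        mooreProj B (m + 1) (altFace B (m + 1) w) := by
      rw [hw, mooreProj_naturality]
    have hFz : FacesZero (((chainsMap (singMap f)).app (op ⦋m + 1⦌)).hom z) := by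
      rw [hz, ← mooreProj_naturality]
      exact facesZero_mooreProj
        (cycleClass.altFace_eq_zero (cycleClass.map hc (chainsMap (singMap f))))
    obtain ⟨W, hW⟩ := exists_altFace_eq_shuffle (coordPairing (f x₀) i j).bilinear rfl w hFz
    refine ⟨W, hW.trans ?_⟩
    rw [← hfz]
    exact (map_shuffle_naturality (coordPairing x₀ i j).bilinear (coordPairing (f x₀) i j).bilinear
      (chainsMap (singMap f)) (chainsMap (singMap f)) (chainsMap (singMap (powMap f n)))
      (fun d a b => SimplicialPairing.map_bilinear _ _ _ _ _
        (fun _ σ τ => powMap_coordPairing f x₀ i j σ τ) a b) z z).symm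
  -- the dual functionals
  let Φ : Fin n → Fin n → C _⦋m + 1 + (m + 1)⦌ →ₗ[ℚ] ℚ := fun k l =>
    alexanderWhitney (singMap (coord X k)) (singMap (coord X l)) φ φ
  have hΦd : ∀ k l w, Φ k l (altFace C _ w) = 0 := fun k l w =>
    alexanderWhitney_altFace _ _ φ φ hφd hφd w
  have hΦdiag : ∀ i j, i < j → Φ i j (e i j) ≠ 0 := by
    intro i j hij
    have := sum_front_back_shuffle hzF z φ φ (coordPairing x₀ i j).bilinear (Φ i j)
      (fun x y => alexanderWhitney_bilinear _ _ _ φ φ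
        (fun σ τ => coord_coordPairing_left x₀ i j σ τ)
        (fun σ τ => coord_coordPairing_right x₀ hij.ne' σ τ) x y)
    rw [show Φ i j (e i j) = _ from this, hφz]
    simp
  have hΦoff : ∀ i j k l, i < j → k < l → ¬ (k = i ∧ l = j) → Φ k l (e i j) = 0 := by
    intro i j k l hij hkl hne
    -- Two distinct increasing pairs: one of `k`, `l` lies outside `{i, j}`, and that coordinate is
    -- constant on the product.
    have hor : (k ≠ i ∧ k ≠ j) ∨ (l ≠ i ∧ l ≠ j) := by
      by_contra hcon
      simp only [not_or, not_and_or, not_not] at hcon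
      rcases hcon with ⟨rfl | rfl, rfl | rfl⟩
      · exact lt_irrefl _ hkl
      · exact hne ⟨rfl, rfl⟩
      · exact lt_asymm hij hkl
      · exact lt_irrefl _ hkl
    have hb : ∀ x y, Φ k l ((coordPairing x₀ i j).bilinear.app _ x y) = 0 := by
      intro x y
      refine alexanderWhitney_bilinear_eq_zero _ _ _ φ φ (hor.imp (fun hk σ τ => ?_)
        fun hl σ τ => ?_) x y
      · rw [coord_coordPairing_of_ne x₀ hk.1 hk.2]
        exact hφP _ (mooreProj_const x₀ _)
      · rw [coord_coordPairing_of_ne x₀ hl.1 hl.2]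
        exact hφP _ (mooreProj_const x₀ _)
    simp only [e, shuffle, map_sum, map_zsmul, hb, smul_zero, Finset.sum_const_zero]
  -- linear independence
  let ι := Σ j : Fin n, Fin j
  let I : ι → Fin n := fun s => ⟨s.2, s.2.2.trans s.1.2⟩
  have hI : ∀ s : ι, I s < s.1 := fun s => s.2.2
  have hinj : ∀ s t : ι, I t = I s ∧ t.1 = s.1 → t = s := by
    rintro ⟨j, i⟩ ⟨j', i'⟩ ⟨h₁, h₂⟩
    obtain rfl : j' = j := h₂
    obtain rfl : i' = i := Fin.ext (congrArg (fun a : Fin n => (a : ℕ)) h₁)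
    rfl
  let v : ι → LinearMap.ker (rationalHomologyMap (m + 1 + (m + 1)) (powMap f n)) := fun s =>
    ⟨κ (I s) s.1, hker _ _⟩
  have hv : LinearIndependent ℚ v := by
    rw [Fintype.linearIndependent_iff]
    intro g hg t
    have hmem : (∑ s, g s • e (I s) s.1, ∑ s, g s • κ (I s) s.1) ∈
        cycleClass C (m + 1 + (m + 1)) := by
      have := Submodule.sum_mem (cycleClass C (m + 1 + (m + 1))) (t := Finset.univ)
        (f := fun s : ι => g s • (e (I s) s.1, κ (I s) s.1))
        fun s _ => Submodule.smul_mem _ _ (hκ _ _)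
      convert this using 1
      ext
      · simp [Prod.fst_sum]
      · simp [Prod.snd_sum]
    have hzero : ∑ s, g s • κ (I s) s.1 = 0 := by
      have := congrArg (Submodule.subtype _) hg
      rw [map_sum, map_zero] at this
      exact this
    obtain ⟨w, hw⟩ := (cycleClass.eq_zero_iff hmem).1 hzero
    -- A vanishing combination of classes bounds, and pairing the boundary with `Φ (I t) t.1`
    -- isolates the coefficient of `t`.
    have h1 := hΦd (I t) t.1 w
    rw [hw, map_sum, Finset.sum_eq_single t] at h1
    · rw [map_smul, smul_eq_mul] at h1
      exact (mul_eq_zero.1 h1).resolve_right (hΦdiag _ _ (hI t))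
    · intro s _ hst
      rw [map_smul, hΦoff _ _ _ _ (hI s) (hI t) fun hh => hst (hinj s t hh).symm, smul_zero]
    · simp
  have hcard : Fintype.card ι = ∑ j ∈ Finset.range n, j := by
    simp [ι, Fintype.card_sigma, Fin.sum_univ_eq_sum_range fun j => j]
  rw [← hcard]
  exact card_le_qdim hv

end Singular
-- Rational homotopy groups of a power.
section HomotopyOfPowers

variable {X : Type u} [TopologicalSpace X]

/-- The map from the homotopy group of a power to the power of the homotopy group. -/
noncomputable def homotopyGroupPowMap (k n : ℕ) (x : X) :
    HomotopyGroup.Pi (k + 2) (Fin n → X) (fun _ => x) →*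
      (Fin n → HomotopyGroup.Pi (k + 2) X x) :=
  MonoidHom.mk' (fun a i => homotopyGroupMap k (coord X i) (fun _ => x) a) fun a b =>
    funext fun i => map_mul (homotopyGroupMap k (coord X i) (fun _ => x)) a b

/-- Loops in a product, and homotopies between them relative to the boundary, are given
coordinatewise. -/
lemma homotopyGroupPowMap_bijective (k n : ℕ) (x : X) :
    Function.Bijective (homotopyGroupPowMap k n x) := by
  constructor
  · rintro ⟨p⟩ ⟨q⟩ h
    have h' : ∀ i, ((coord X i).comp p.1).HomotopicRel ((coord X i).comp q.1)
        (Cube.boundary (Fin (k + 2))) := fun i => Quotient.exact (congrFun h i)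
    refine Quotient.sound ?_
    exact ⟨ContinuousMap.HomotopyRel.pi fun i => (h' i).some⟩
  · intro a
    choose p hp using fun i => Quotient.exists_rep (a i)
    refine ⟨Quotient.mk _ ⟨⟨fun t i => p i t, continuous_pi fun i => (p i).1.continuous⟩,
      fun t ht => funext fun i => (p i).2 t ht⟩, funext fun i => ?_⟩
    rw [← hp i]
    rfl

/-- The rational homotopy of a power. -/
noncomputable def rationalPiPowEquiv (k n : ℕ) (x : X) :
    rationalPi k (Fin n → X) (fun _ => x) ≃ₗ[ℚ] (Fin n → rationalPi k X x) :=
  let e : Additive (HomotopyGroup.Pi (k + 2) (Fin n → X) (fun _ => x)) ≃+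
      (Fin n → Additive (HomotopyGroup.Pi (k + 2) X x)) :=
    AddEquiv.mk' (Equiv.ofBijective _ (homotopyGroupPowMap_bijective k n x))
      fun a b => map_mul (homotopyGroupPowMap k n x) a.toMul b.toMul
  (e.toIntLinearEquiv.baseChange ℤ ℚ _ _).trans
    (TensorProduct.piRight ℤ ℚ ℚ fun _ : Fin n => Additive (HomotopyGroup.Pi (k + 2) X x))

end HomotopyOfPowers

/-! ### Dimension counts, and quadratic against linear growth. -/

section Dimensions

lemma qdim_le_of_injective {V W : Type u} [AddCommGroup V] [Module ℚ V] [AddCommGroup W]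
    [Module ℚ W] (f : V →ₗ[ℚ] W) (hf : Function.Injective f) : qdim V ≤ qdim W :=
  ENat.toENNReal_mono (Cardinal.gciENat.gc.monotone_u (LinearMap.rank_le_of_injective f hf))

lemma qdim_pi (n : ℕ) (V : Type u) [AddCommGroup V] [Module ℚ V] :
    qdim (Fin n → V) = n * qdim V := by
  rw [qdim, rank_fun_eq_lift_mul, qdim]
  simp

lemma qdim_ne_zero_iff {V : Type u} [AddCommGroup V] [Module ℚ V] :
    qdim V ≠ 0 ↔ Nontrivial V := by
  rw [qdim, ← rank_pos_iff_nontrivial (R := ℚ), pos_iff_ne_zero]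
  simp

lemma exists_mul_le_sum_range_mul {S c : ℝ≥0} (hc : 0 < c) :
    ∃ N : ℕ, 0 < N ∧ ∀ n : ℕ, N ≤ n → n * S ≤ (∑ j ∈ Finset.range n, j : ℕ) * c := by
  -- As the sum is `n(n-1)/2`, it suffices that `n - 1 ≥ 2S/c`.
  obtain ⟨N, hN⟩ := exists_nat_ge (2 * S / c)
  rw [div_le_iff₀ hc] at hN
  refine ⟨N + 1, by omega, fun n hn => ?_⟩
  obtain ⟨m, rfl⟩ : ∃ m, n = m + 1 := ⟨n - 1, by omega⟩
  have h2 : ((∑ j ∈ Finset.range (m + 1), j : ℕ) : ℝ≥0) * 2 = (m + 1) * m := by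
    exact_mod_cast Finset.sum_range_id_mul_two (m + 1)
  have hm : (N : ℝ≥0) ≤ m := by exact_mod_cast (by omega : N ≤ m)
  refine le_of_mul_le_mul_right ?_ (zero_lt_two' ℝ≥0)
  calc ((m + 1 : ℕ) : ℝ≥0) * S * 2 = (m + 1) * (2 * S) := by push_cast; ring
    _ ≤ (m + 1) * (m * c) := by exact mul_le_mul_right (hN.trans (mul_le_mul_left hm c)) _
    _ = (∑ j ∈ Finset.range (m + 1), j : ℕ) * c * 2 := by rw [mul_right_comm, h2]; ring

end Dimensions

/-! ### Bounds for the two series. -/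

section HilbertPoincare

variable {X Y : Type u} [TopologicalSpace X] [TopologicalSpace Y]

lemma spaceHilbertPoincare_lt_top {x : X} {r : ℝ≥0} (hr : (r : ℝ≥0∞) < homotopyRadius X x) :
    spaceHilbertPoincare X x r < ∞ := by
  simp only [homotopyRadius, lt_iSup_iff] at hr
  obtain ⟨t, ht, hrt⟩ := hr
  refine lt_of_le_of_lt (ENNReal.tsum_le_tsum fun k => ?_) ht
  gcongr

/-- In each degree the kernel is bounded by the whole space `π_i(X^n) ⊗ ℚ`, a sum of `n` copies of
`π_i(X) ⊗ ℚ`. -/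
lemma homotopicalHilbertPoincare_powMap_le (f : C(X, Y)) (x : X) (n : ℕ) (r : ℝ≥0) :
    homotopicalHilbertPoincare (powMap f n) (fun _ => x) r ≤ n * spaceHilbertPoincare X x r := by
  rw [homotopicalHilbertPoincare, spaceHilbertPoincare, ← ENNReal.tsum_mul_left]
  refine ENNReal.tsum_le_tsum fun k => ?_
  rw [← mul_assoc, ← qdim_pi]
  gcongr
  exact qdim_le_of_injective ((rationalPiPowEquiv k n x).toLinearMap.comp
    (LinearMap.ker (rationalPiMap k (powMap f n) fun _ => x)).subtype)
    ((rationalPiPowEquiv k n x).injective.comp (Submodule.subtype_injective _))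

lemma exists_ne_zero_of_one_lt_homologicalPoincare {f : C(X, Y)}
    (hP : 1 < homologicalPoincare f 1) :
    ∃ (k : ℕ) (h : rationalHomology (k + 2) X), h ≠ 0 ∧ rationalHomologyMap (k + 2) f h = 0 := by
  by_contra! hcon
  refine hP.ne' ?_
  rw [homologicalPoincare]
  have : ∀ k, qdim (LinearMap.ker (rationalHomologyMap (k + 2) f)) = 0 := by
    intro k
    by_contra hk
    obtain ⟨⟨a, ha⟩, hne⟩ := @exists_ne _ (qdim_ne_zero_iff.1 hk) 0
    exact hcon k a (fun h0 => hne (Subtype.ext h0)) ha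
  simp [this]

end HilbertPoincare

end RelHilali

theorem mainTheorem5 {X Y : Type u} [TopologicalSpace X] [TopologicalSpace Y]
    [SimplyConnectedSpace X] [SimplyConnectedSpace Y]
    (hX : RelHilali.FiniteTypeQ X) (hY : RelHilali.FiniteTypeQ Y)
    (f : C(X, Y)) (x₀ : X)
    (hf : RelHilali.RationallyHyperbolicKer f x₀)
    (hP : 1 < RelHilali.homologicalPoincare f 1)
    (r : ℝ≥0) (hr₀ : 0 < r) (hr : (r : ℝ≥0∞) < RelHilali.homotopyRadius X x₀) :
    ∃ N : ℕ, 0 < N ∧ ∀ n : ℕ, N ≤ n →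
      RelHilali.homotopicalHilbertPoincare (RelHilali.powMap f n) (fun _ => x₀) r <
        RelHilali.homologicalPoincare (RelHilali.powMap f n) r := by
  obtain ⟨k, h, h0, hh⟩ := RelHilali.exists_ne_zero_of_one_lt_homologicalPoincare hP
  have hS := RelHilali.spaceHilbertPoincare_lt_top hr
  obtain ⟨S, hSe⟩ := WithTop.ne_top_iff_exists.1 hS.ne
  obtain ⟨N, hN, H⟩ := RelHilali.exists_mul_le_sum_range_mul (S := S)
    (pow_pos hr₀ (k + 2 + (k + 2)))
  refine ⟨N, hN, fun n hn => ?_⟩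
  have hle : RelHilali.homotopicalHilbertPoincare (RelHilali.powMap f n) (fun _ => x₀) r ≤
      (n * S : ℝ≥0) := by
    refine (RelHilali.homotopicalHilbertPoincare_powMap_le f x₀ n r).trans ?_
    rw [← hSe]
    push_cast
    exact le_rfl
  have hlt : ((n * S : ℝ≥0) : ℝ≥0∞) ≤ ∑' i : ℕ, RelHilali.qdim (LinearMap.ker
      (RelHilali.rationalHomologyMap (i + 2) (RelHilali.powMap f n))) *
        (r : ℝ≥0∞) ^ (i + 2) := by
    -- Series indices are degrees shifted by two, so this is the term of degree `2(k + 2)`.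
    refine le_trans ?_ (ENNReal.le_tsum (k + 2 + k))
    refine (ENNReal.coe_le_coe.2 (H n hn)).trans ?_
    rw [ENNReal.coe_mul, ENNReal.coe_pow, ENNReal.coe_natCast]
    exact mul_le_mul_left (RelHilali.sum_range_le_qdim_ker f x₀ (m := k + 1) h0 hh n) _
  -- Strictness comes from the constant term `1` of the homological series.
  refine hle.trans_lt ((ENNReal.lt_add_right ENNReal.coe_ne_top one_ne_zero).trans_le ?_)
  rw [RelHilali.homologicalPoincare, add_comm]
  gcongr
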